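/- **Setting.** A group-server queue has Poisson arrivals of rate $\lambda>0$ and $K$ server groups; group $k$ has $M_k$ exponential servers, each with service rate $\mu_k>0$ and operating cost rate $c_k\ge 0$. Different groups are heterogeneous: $(\mu_k,c_k)\ne(\mu_l,c_l)$ for $k\neq l$. The holding cost rate $h(n)$ in state $n$ (the number of customers) is increasing and convex in $n$, with $h(n)\to\infty$. An (efficient, stationary) policy $d$ assigns to each $n\in\mathbb N$ numbers $d(n,k)\in\{0,\dots,M_k\}$ of working servers with $\sum_k d(n,k)\le n$. Under $d$ the number of customers $n_t$ is the continuous-time birth-death chain with birth rate $\lambda$ and death rate $\sum_k d(n,k)\mu_k$ in state $n$, and costs accrue at rate $f(n,d(n))=h(n)+\sum_k d(n,k)c_k$. The long-run average cost is $$\eta^d=\lim_{T\to\infty}\frac1T\,\mathbb E\Big[\int_0^T f(n_t,d(n_t))\,dt \,\Big|\, n_0=n\Big]$$ (finite if this is a finite limit, the same for every initial state $n$). A policy is optimal if $\eta^d$ is finite and $\eta^d\le\eta^{d'}$ for every policy $d'$ with finite $\eta^{d'}$. A performance potential of a policy $d$ of finite average cost is a function $g$ with $g(n)=\mathbb E[\int_0^\infty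 (f(n_t,d(n_t))-\eta^d)\,dt\mid n_0=n]$ up to an additive constant, i.e. for all $n$ $$g(n)-g(0)=\lim_{T\to\infty}\Big(\mathbb E\Big[\int_0^T (f-\eta^d)\,dt\,\Big|\,n_0=n\Big]-\mathbb E\Big[\int_0^T (f-\eta^d)\,dt\,\Big|\,n_0=0\Big]\Big),$$ and $G(n)=g(n)-g(n-1)$, $n\ge1$, is its perturbation realization factor. (For $n=0$ all $d(0,k)$ are $0$ and the value of $G(0)$, set to $0$, is irrelevant.) **Theorem ($c/\mu$-rule).** Assume scale economies: the groups are numbered so that $\frac{c_1}{\mu_1}\le\dots\le\frac{c_K}{\mu_K}$, and then $\mu_1\ge\dots\ge\mu_K$. Let $d^*$ be a policy. 1. $d^*$ is optimal if and only if it has a performance potential, with perturbation realization factor $G^*$, and for all $n\in\mathbb N$ and $k=1,\dots,K$: $$G^*(n)>\tfrac{c_k}{\mu_k}\ \Rightarrow\ d^*(n,k)=M_k\wedge\Big(n-\sum_{l=1}^{k-1}d^*(n,l)\Big),\qquad G^*(n)<\tfrac{c_k}{\mu_k}\ \Rightarrow\ d^*(n,k)=0 .$$ 2. Suppose that $d^*$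 has a performance potential and keeps indifferent servers off, i.e. $d^*(n,k)=0$ whenever $G^*(n)=\frac{c_k}{\mu_k}$. Then $d^*$ is optimal if and only if for all $n\in\mathbb N$, $k=1,\dots,K$: $d^*(n,k)=M_k\wedge\big(n-\sum_{l=1}^{k-1}d^*(n,l)\big)$ if $G^*(n)>\frac{c_k}{\mu_k}$, and $d^*(n,k)=0$ otherwise. So groups with smaller $c/\mu$ are switched on first, in an order that does not depend on the state. -/

import Mathlib

/-- The data of a group-server queue with `K` server groups: Poisson arrivals of rate `lam`;
group `k` has `M k` exponential servers, each of service rate `mu k` and operating cost rate `c k`;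
`h n` is the holding cost rate when `n` customers are present. -/
structure GroupServerQueue (K : ℕ) where
  lam : ℝ
  M : Fin K → ℕ
  mu : Fin K → ℝ
  c : Fin K → ℝ
  h : ℕ → ℝ
  lam_pos : 0 < lam
  mu_pos : ∀ k, 0 < mu k
  c_nonneg : ∀ k, 0 ≤ c k
  /-- Distinct groups are heterogeneous: they differ in service rate or in cost rate. -/
  heterogeneous : ∀ k l, k ≠ l → mu k ≠ mu l ∨ c k ≠ c l
  /-- The holding cost is increasing, convex, and tends to infinity. -/
  h_mono : Monotone h
  h_convex : ∀ n, 2 * h (n + 1) ≤ h n + h (n + 2)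
  h_tendsto : Filter.Tendsto h Filter.atTop Filter.atTop

namespace GroupServerQueue

variable {K : ℕ} (Q : GroupServerQueue K)

/-- Efficient stationary policies: `d n k` is the number of working servers of group `k` in
state `n`; at most `M k` of them exist, and no more servers work than there are customers. -/
def IsEfficient (d : ℕ → Fin K → ℕ) : Prop :=
  ∀ n, (∀ k, d n k ≤ Q.M k) ∧ ∑ k, d n k ≤ n

/-- Total service rate in state `n`. -/
noncomputable def rate (d : ℕ → Fin K → ℕ) (n : ℕ) : ℝ :=
  ∑ k, (d n k : ℝ) * Q.mu k

/-- Total cost rate `f(n, d(n))` in state `n`: holding cost plus operating cost. -/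
noncomputable def cost (d : ℕ → Fin K → ℕ) (n : ℕ) : ℝ :=
  Q.h n + ∑ k, (d n k : ℝ) * Q.c k

/-- The infinitesimal generator `B` of the number of customers under `d` (a birth-death process).
An efficient policy has `rate d 0 = 0`, so that the rows sum to zero. -/
noncomputable def gen (d : ℕ → Fin K → ℕ) (n m : ℕ) : ℝ :=
  if m = n + 1 then Q.lam
  else if m + 1 = n then Q.rate d n
  else if m = n then -(Q.lam + Q.rate d n)
  else 0

/-- The bound `Λ = λ + ∑ M_k μ_k` of all jump rates. -/
noncomputable def unifRate : ℝ :=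
  Q.lam + ∑ k, (Q.M k : ℝ) * Q.mu k

/-- The `j`-step transition probabilities of the uniformized jump chain, i.e. the entries of the
power `(I + B / Λ) ^ j`. (The sum over `i` has at most three nonzero terms.) -/
noncomputable def jumpProb (d : ℕ → Fin K → ℕ) : ℕ → ℕ → ℕ → ℝ
  | 0, n, m => if n = m then 1 else 0
  | j + 1, n, m =>
      ∑' i, ((if n = i then 1 else 0) + Q.gen d n i / Q.unifRate) * jumpProb d j i m

/-- The transition probabilities `P(n_t = m | n_0 = n)` of the continuous-time Markov chain with
generator `B`: the entries of `exp (t B) = ∑ⱼ e^{-Λ t} (Λ t)^j / j! (I + B / Λ)^j`. -/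
noncomputable def transProb (d : ℕ → Fin K → ℕ) (t : ℝ) (n m : ℕ) : ℝ :=
  ∑' j : ℕ, Real.exp (-(Q.unifRate * t)) * (Q.unifRate * t) ^ j / (j.factorial : ℝ)
    * Q.jumpProb d j n m

/-- `E[f(n_t, d(n_t)) | n_0 = n]`. -/
noncomputable def expCost (d : ℕ → Fin K → ℕ) (t : ℝ) (n : ℕ) : ℝ :=
  ∑' m, Q.transProb d t n m * Q.cost d m

/-- The long-run average cost of `d` is the (finite) number `eta`: from every initial state `n`
the expected costs are finite and `(1/T) E[∫₀ᵀ f(n_t, d(n_t)) dt | n_0 = n] → eta`. -/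
def HasAverageCost (d : ℕ → Fin K → ℕ) (eta : ℝ) : Prop :=
  ∀ n,
    (∀ t, 0 ≤ t → Summable fun m => Q.transProb d t n m * Q.cost d m) ∧
    (∀ T, 0 ≤ T → IntervalIntegrable (fun t => Q.expCost d t n) MeasureTheory.volume 0 T) ∧
    Filter.Tendsto (fun T : ℝ => (1 / T) * ∫ t in (0 : ℝ)..T, Q.expCost d t n)
      Filter.atTop (nhds eta)

/-- `d` is an (efficient) policy of minimal long-run average cost. A policy without a finite
average cost (average cost `+∞`) is not optimal and never competes. -/
def IsOptimal (d : ℕ → Fin K → ℕ) : Prop :=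
  Q.IsEfficient d ∧ ∃ eta, Q.HasAverageCost d eta ∧
    ∀ d' eta', Q.IsEfficient d' → Q.HasAverageCost d' eta' → eta ≤ eta'

/-- `g` is a performance potential (relative value function, bias) of `d`:
`g(n) = E[∫₀^∞ (f(n_t, d(n_t)) - eta) dt | n_0 = n]` up to an additive constant. The constant is
removed before the limit `T → ∞` is taken, so that the notion makes sense for every policy of
finite average cost; if the integrals over `[0, ∞)` converge, they form such a `g`. -/
def IsPotential (d : ℕ → Fin K → ℕ) (g : ℕ → ℝ) : Prop :=
  ∃ eta, Q.HasAverageCost d eta ∧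
    ∀ n, Filter.Tendsto
      (fun T : ℝ => (∫ t in (0 : ℝ)..T, (Q.expCost d t n - eta))
        - ∫ t in (0 : ℝ)..T, (Q.expCost d t 0 - eta))
      Filter.atTop (nhds (g n - g 0))

/-- Groups are numbered by increasing `c_k / μ_k`, and then the `μ_k` are non-increasing. -/
def ScaleEconomies : Prop :=
  Monotone (fun k => Q.c k / Q.mu k) ∧ Antitone Q.mu

end GroupServerQueue

/-- The perturbation realization factor `G(n) = g(n) - g(n-1)`, `n ≥ 1` (and `0` at `n = 0`, where
its value is irrelevant because no server can work). -/
def prf (g : ℕ → ℝ) (n : ℕ) : ℝ :=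
  g n - g (n - 1)

/-!
Uniformization turns the queue into a discrete-time birth-death walk run at Poisson times. Since
`h → ∞`, the occupation measures of a policy of finite average cost are tight, and their limit
points are stationary distributions of no larger mean cost. For an irreducible policy with
stationary distribution `w`, the partial sums of `w * (η - f)` solve the Poisson equation; the
increments of the transition operator are governed by a transient dual walk, which makes this
solution the performance potential.

Summation by parts of the balance equations gives the performance difference formula: up to a
boundary term, the costs of two policies differ by the stationary mean of the difference of their
net benefits `∑ k, d n k * (μ k * G n - c k)`. Under scale economies the actions allowed by the
`c/μ`-rule are exactly the maximizers of the net benefit. If `d` obeys the rule, then `G → ∞`, so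
that `d` eventually uses all servers and the boundary term vanishes: `d` is optimal. Conversely,
changing an optimal `d` in a single state shows that it maximizes the net benefit there. This needs
an irreducible `d` with `min c/μ < G`, and both follow by comparing `d` with the policies that use
a single cheapest server up to some state.
-/

open Filter MeasureTheory Topology
open scoped Nat

/-- A form of the Silverman–Toeplitz theorem. -/
theorem tendsto_tsum_mul_of_tendsto_zero {ι : Type*} {l : Filter ι} {k : ι → ℕ → ℝ} {s : ℕ → ℝ}
    (hk_nonneg : ∀ᶠ i in l, ∀ n, 0 ≤ k i n)
    (hk_sum : ∀ᶠ i in l, ∀ N, ∑ n ∈ Finset.range N, k i n ≤ 1)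
    (hk : ∀ n, Tendsto (k · n) l (𝓝 0)) (hs : Tendsto s atTop (𝓝 0)) :
    Tendsto (fun i => ∑' n, k i n * s n) l (𝓝 0) := by
  rw [Metric.tendsto_nhds]
  intro ε hε
  obtain ⟨N, hN⟩ := Metric.tendsto_atTop.1 hs (ε / 2) (half_pos hε)
  have head_lt : ∀ᶠ i in l, ∑ n ∈ Finset.range N, k i n * |s n| < ε / 2 := by
    have h := tendsto_finsetSum (Finset.range N) fun n _ => (hk n).mul_const |s n|
    simp only [zero_mul, Finset.sum_const_zero] at h
    exact h.eventually_lt_const (half_pos hε)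
  filter_upwards [hk_nonneg, hk_sum, head_lt] with i h0 h1 hhead
  have head_sum := hasSum_sum_of_ne_finset_zero (s := Finset.range N) (L := .unconditional ℕ)
    (f := fun n => if n < N then k i n * |s n| else 0)
    fun n hn => if_neg fun h => hn (Finset.mem_range.2 h)
  rw [Finset.sum_congr rfl fun n hn => if_pos (Finset.mem_range.1 hn)] at head_sum
  have weights_sum := (summable_of_sum_range_le h0 h1).hasSum.mul_right (ε / 2)
  have term_le (n : ℕ) :
      ‖k i n * s n‖ ≤ (if n < N then k i n * |s n| else 0) + k i n * (ε / 2) := by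
    rw [norm_mul, Real.norm_eq_abs, Real.norm_eq_abs, abs_of_nonneg (h0 n)]
    split_ifs with h
    · exact le_add_of_nonneg_right (mul_nonneg (h0 n) (half_pos hε).le)
    · rw [zero_add]
      have hsn := hN n (not_lt.1 h)
      rw [Real.dist_eq, sub_zero] at hsn
      exact mul_le_mul_of_nonneg_left hsn.le (h0 n)
  rw [dist_zero_right]
  calc ‖∑' n, k i n * s n‖
      ≤ ∑ n ∈ Finset.range N, k i n * |s n| + (∑' n, k i n) * (ε / 2) :=
        tsum_of_norm_bounded (head_sum.add weights_sum) term_le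
    _ ≤ ∑ n ∈ Finset.range N, k i n * |s n| + 1 * (ε / 2) := by
        gcongr
        exact Real.tsum_le_of_sum_range_le h0 h1
    _ < ε := by linarith

theorem hasSum_cols_of_hasSum_rows {α β : Type*} {F : α → β → ℝ} {r : α → ℝ} {c : β → ℝ} {x : ℝ}
    (hF : ∀ a b, 0 ≤ F a b) (hr : ∀ a, HasSum (F a) (r a)) (hc : ∀ b, HasSum (F · b) (c b))
    (hx : HasSum r x) : HasSum c x := by
  have hsum : Summable (Function.uncurry F) := by
    refine (summable_prod_of_nonneg fun p => hF p.1 p.2).2 ⟨fun a => (hr a).summable, ?_⟩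
    simpa only [Function.uncurry_apply_pair, (hr _).tsum_eq] using hx.summable
  have hFx : HasSum (Function.uncurry F) x := by
    rw [← (hsum.hasSum.prod_fiberwise hr).unique hx]
    exact hsum.hasSum
  exact ((Equiv.prodComm β α).hasSum_iff.2 hFx).prod_fiberwise hc

theorem hasSum_mul_sub_const_iff {ι : Type*} {p u : ι → ℝ} {b x : ℝ} (hp : HasSum p 1) :
    HasSum (fun i => p i * (u i - b)) (x - b) ↔ HasSum (fun i => p i * u i) x := by
  have hb : HasSum (fun i => p i * b) b := by simpa only [one_mul] using hp.mul_right b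
  simp only [mul_sub]
  exact ⟨fun h => by simpa only [sub_add_cancel] using h.add hb, fun h => h.sub hb⟩

theorem tendsto_average_of_tendsto {u : ℝ → ℝ} {L : ℝ}
    (hi : ∀ T, 0 ≤ T → IntervalIntegrable u volume 0 T) (hu : Tendsto u atTop (𝓝 L)) :
    Tendsto (fun T : ℝ => (1 / T) * ∫ t in (0 : ℝ)..T, u t) atTop (𝓝 L) := by
  suffices h : (fun T => ∫ t in (0 : ℝ)..T, (u t - L)) =o[atTop] fun T : ℝ => T by
    refine (h.tendsto_div_nhds_zero.add_const L).congr' ?_ |>.trans (by rw [zero_add])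
    filter_upwards [eventually_gt_atTop 0] with T hT
    rw [intervalIntegral.integral_sub (hi T hT.le) intervalIntegrable_const,
      intervalIntegral.integral_const, smul_eq_mul, sub_zero]
    field_simp
    ring
  refine Asymptotics.isLittleO_iff.2 fun ε hε => ?_
  obtain ⟨S, hS0, hS⟩ : ∃ S, 0 ≤ S ∧ ∀ t, S ≤ t → |u t - L| ≤ ε / 2 := by
    obtain ⟨S, hS⟩ := Metric.tendsto_atTop.1 hu (ε / 2) (half_pos hε)
    exact ⟨max S 0, le_max_right _ _, fun t ht => (hS t ((le_max_left _ _).trans ht)).le⟩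
  have hiL (T : ℝ) (hT : 0 ≤ T) : IntervalIntegrable (fun t => u t - L) volume 0 T :=
    (hi T hT).sub intervalIntegrable_const
  have head_le : ∀ᶠ T : ℝ in atTop, ‖∫ t in (0 : ℝ)..S, (u t - L)‖ ≤ ε / 2 * T :=
    (tendsto_id.const_mul_atTop (half_pos hε)).eventually_ge_atTop _
  filter_upwards [head_le, eventually_ge_atTop S] with T hT hST
  have hT0 := hS0.trans hST
  rw [← intervalIntegral.integral_add_adjacent_intervals (hiL S hS0)
    ((hiL S hS0).symm.trans (hiL T hT0)), Real.norm_of_nonneg hT0]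
  have tail_le : ‖∫ t in S..T, (u t - L)‖ ≤ ε / 2 * |T - S| :=
    intervalIntegral.norm_integral_le_of_norm_le_const fun t ht =>
      hS t (Set.uIoc_of_le hST ▸ ht).1.le
  rw [abs_of_nonneg (sub_nonneg.2 hST)] at tail_le
  have : 0 ≤ ε / 2 * S := by positivity
  linarith [norm_add_le (∫ t in (0 : ℝ)..S, (u t - L)) (∫ t in S..T, (u t - L))]

section PoissonMix

variable {x y : ℕ → ℝ}

/-- The mixture of the sequence `x` over a Poisson law of mean `s`. -/
noncomputable def poissonMix (x : ℕ → ℝ) (s : ℝ) : ℝ :=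
  ∑' j : ℕ, Real.exp (-s) * s ^ j / j ! * x j

/-- The sequences all of whose Poisson mixtures converge, i.e. whose exponential generating
function is entire. Negative means are included, which costs nothing (see
`PoissonSummable.of_nonneg`) and frees the calculus of `poissonMix` from sign conditions. -/
def PoissonSummable (x : ℕ → ℝ) : Prop :=
  ∀ s : ℝ, Summable fun j : ℕ => s ^ j / j ! * x j

theorem PoissonSummable.of_nonneg
    (h : ∀ s : ℝ, 0 ≤ s → Summable fun j : ℕ => Real.exp (-s) * s ^ j / j ! * x j) :
    PoissonSummable x := by
  intro s
  refine .of_norm (((h |s| (abs_nonneg s)).abs.mul_left (Real.exp |s|)).congr fun j => ?_)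
  have hexp : Real.exp |s| * Real.exp (-|s|) = 1 := by rw [← Real.exp_add]; simp
  simp only [norm_mul, norm_div, norm_pow, Real.norm_eq_abs, abs_mul, abs_div, abs_pow, abs_abs,
    Nat.abs_cast, Real.abs_exp]
  linear_combination (|s| ^ j / j ! * |x j|) * hexp

theorem PoissonSummable.of_bounded {C : ℝ} (h : ∀ j, |x j| ≤ C) : PoissonSummable x := by
  intro s
  refine .of_norm_bounded ((Real.summable_pow_div_factorial |s|).mul_right C) fun j => ?_
  simp only [norm_mul, norm_div, norm_pow, Real.norm_eq_abs, Nat.abs_cast]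
  gcongr
  exact h j

theorem PoissonSummable.const (b : ℝ) : PoissonSummable fun _ => b :=
  .of_bounded fun _ => le_rfl

theorem PoissonSummable.sub (hx : PoissonSummable x) (hy : PoissonSummable y) :
    PoissonSummable fun j => x j - y j := fun s => by
  simpa only [mul_sub] using (hx s).sub (hy s)

theorem PoissonSummable.const_mul (hx : PoissonSummable x) (b : ℝ) :
    PoissonSummable fun j => b * x j := fun s => by
  simpa only [mul_left_comm] using (hx s).mul_left b

theorem PoissonSummable.succ (hx : PoissonSummable x) :
    PoissonSummable fun j => x (j + 1) := by
  intro s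
  set R := |s| + 1
  have hsum := (summable_nat_add_iff 1).2 (hx (2 * R)).abs
  refine .of_norm_bounded hsum fun j => ?_
  have hpow : ((j : ℝ) + 1) * |s| ^ j ≤ (2 * R) ^ (j + 1) := by
    have h2 : (j : ℝ) + 1 ≤ 2 ^ (j + 1) := by exact_mod_cast Nat.lt_two_pow_self.le
    have hR : |s| ^ j ≤ R ^ (j + 1) :=
      (pow_le_pow_left₀ (abs_nonneg s) (le_add_of_nonneg_right zero_le_one) j).trans
        (pow_le_pow_right₀ (le_add_of_nonneg_left (abs_nonneg s)) j.le_succ)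
    rw [mul_pow]
    gcongr
  simp only [norm_mul, norm_div, norm_pow, Real.norm_eq_abs, abs_mul, abs_div, abs_pow,
    Nat.abs_cast, abs_of_nonneg (by positivity : 0 ≤ 2 * R)]
  refine mul_le_mul_of_nonneg_right ?_ (abs_nonneg _)
  rw [div_le_div_iff₀ (by positivity) (by positivity), Nat.factorial_succ]
  push_cast
  nlinarith [mul_le_mul_of_nonneg_right hpow (Nat.cast_nonneg (α := ℝ) j !)]

theorem PoissonSummable.summable (hx : PoissonSummable x) (s : ℝ) :
    Summable fun j : ℕ => Real.exp (-s) * s ^ j / j ! * x j := by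
  simpa only [mul_assoc, mul_div_assoc] using (hx s).mul_left (Real.exp (-s))

theorem poissonMix_sub (hx : PoissonSummable x) (hy : PoissonSummable y) (s : ℝ) :
    poissonMix (fun j => x j - y j) s = poissonMix x s - poissonMix y s := by
  simp only [poissonMix, mul_sub, (hx.summable s).tsum_sub (hy.summable s)]

theorem poissonMix_const_mul (x : ℕ → ℝ) (b s : ℝ) :
    poissonMix (fun j => b * x j) s = b * poissonMix x s := by
  simp only [poissonMix, mul_left_comm, tsum_mul_left]

theorem hasSum_poissonWeight (s : ℝ) : HasSum (fun j : ℕ => Real.exp (-s) * s ^ j / j !) 1 := by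
  have h := (NormedSpace.expSeries_div_hasSum_exp s).mul_left (Real.exp (-s))
  rw [← Real.exp_eq_exp_ℝ, ← Real.exp_add, neg_add_cancel, Real.exp_zero] at h
  simpa only [mul_div_assoc] using h

theorem poissonMix_const (b s : ℝ) : poissonMix (fun _ => b) s = b := by
  simpa only [poissonMix, one_mul] using ((hasSum_poissonWeight s).mul_right b).tsum_eq

theorem poissonMix_zero (x : ℕ → ℝ) : poissonMix x 0 = x 0 := by
  rw [poissonMix, tsum_eq_single 0 fun j hj => by simp [hj]]
  simp

theorem poissonMix_nonneg (hx : ∀ j, 0 ≤ x j) {s : ℝ} (hs : 0 ≤ s) : 0 ≤ poissonMix x s :=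
  tsum_nonneg fun j => mul_nonneg (by positivity) (hx j)

theorem poissonMix_le {C : ℝ} (hx : PoissonSummable x) (hC : ∀ j, x j ≤ C) {s : ℝ} (hs : 0 ≤ s) :
    poissonMix x s ≤ C := by
  have h := poissonMix_nonneg (fun j => sub_nonneg.2 (hC j)) hs
  rwa [poissonMix_sub (.const C) hx, poissonMix_const, sub_nonneg] at h

theorem PoissonSummable.hasDerivAt_tsum (hx : PoissonSummable x) (s : ℝ) :
    HasDerivAt (fun s : ℝ => ∑' j : ℕ, s ^ j / j ! * x j) (∑' j : ℕ, s ^ j / j ! * x (j + 1))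
      s := by
  set R := |s| + 1 with hR
  set g' : ℕ → ℝ → ℝ := fun j r => j * r ^ (j - 1) / j ! * x j with hg'
  have hg'_succ (j : ℕ) (r : ℝ) : g' (j + 1) r = r ^ j / j ! * x (j + 1) := by
    simp only [hg', Nat.add_sub_cancel, Nat.factorial_succ, Nat.cast_mul]
    field_simp
  have hg'_summable (r : ℝ) : Summable fun j => g' j r := by
    rw [← summable_nat_add_iff 1]
    simpa only [hg'_succ] using hx.succ r
  have hg'_tsum : ∑' j, g' j s = ∑' j : ℕ, s ^ j / j ! * x (j + 1) := by
    rw [(hg'_summable s).tsum_eq_zero_add]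
    simp only [hg'_succ]
    simp [hg']
  rw [← hg'_tsum]
  refine hasDerivAt_tsum_of_isPreconnected (u := fun j => |g' j R|) (t := Metric.ball 0 R)
    (y₀ := s) (hg'_summable R).abs Metric.isOpen_ball (convex_ball _ _).isPreconnected
    (fun j r _ => ((hasDerivAt_pow j r).div_const _).mul_const (x j)) (fun j r hr => ?_)
    ?_ (hx s) ?_
  · have hrR : |r| ≤ |R| := (mem_ball_zero_iff.1 hr).le.trans (le_abs_self R)
    simp only [hg', Real.norm_eq_abs, abs_div, abs_mul, abs_pow]
    gcongr
  all_goals simp [hR]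

theorem PoissonSummable.hasDerivAt (hx : PoissonSummable x) (s : ℝ) :
    HasDerivAt (poissonMix x) (poissonMix (fun j => x (j + 1) - x j) s) s := by
  have hmix (x : ℕ → ℝ) :
      poissonMix x = fun s => Real.exp (-s) * ∑' j : ℕ, s ^ j / j ! * x j := by
    ext s
    simp only [poissonMix, ← tsum_mul_left, mul_assoc, mul_div_assoc]
  rw [poissonMix_sub hx.succ hx, hmix x, hmix]
  refine ((hasDerivAt_neg s).exp.mul (hx.hasDerivAt_tsum s)).congr_deriv ?_
  ring

theorem PoissonSummable.continuous (hx : PoissonSummable x) : Continuous (poissonMix x) :=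
  continuous_iff_continuousAt.2 fun s => (hx.hasDerivAt s).continuousAt

/-- Dynkin's formula for a chain whose jumps form a Poisson process of rate `L`. -/
theorem PoissonSummable.integral_poissonMix (hx : PoissonSummable x) (L T : ℝ) :
    ∫ t in (0 : ℝ)..T, poissonMix (fun j => L * (x (j + 1) - x j)) (L * t)
      = poissonMix x (L * T) - x 0 := by
  have hcont : Continuous fun t => poissonMix (fun j => L * (x (j + 1) - x j)) (L * t) :=
    ((hx.succ.sub hx).const_mul L).continuous.comp (continuous_const.mul continuous_id)
  rw [intervalIntegral.integral_eq_sub_of_hasDerivAt (f := fun t => poissonMix x (L * t))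
    (fun t _ => ?_) (hcont.intervalIntegrable _ _), mul_zero, poissonMix_zero]
  refine ((hx.hasDerivAt (L * t)).comp t ((hasDerivAt_id' t).const_mul L)).congr_deriv ?_
  rw [poissonMix_const_mul, mul_one, mul_comm]

theorem tendsto_poissonMix {L : ℝ} (hx : PoissonSummable x) (hL : Tendsto x atTop (𝓝 L)) :
    Tendsto (poissonMix x) atTop (𝓝 L) := by
  have hweight (j : ℕ) : Tendsto (fun s : ℝ => Real.exp (-s) * s ^ j / j !) atTop (𝓝 0) := by
    simpa only [mul_comm, zero_div] using
      (Real.tendsto_pow_mul_exp_neg_atTop_nhds_zero j).div_const (j ! : ℝ)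
  have hnonneg : ∀ᶠ s : ℝ in atTop, ∀ j : ℕ, 0 ≤ Real.exp (-s) * s ^ j / j ! := by
    filter_upwards [eventually_ge_atTop 0] with s hs j
    positivity
  have h := tendsto_tsum_mul_of_tendsto_zero hnonneg
    (hnonneg.mono fun s hs N => sum_le_hasSum _ (fun j _ => hs j) (hasSum_poissonWeight s))
    hweight (tendsto_sub_nhds_zero_iff.2 hL)
  have hmix (s : ℝ) : poissonMix (fun j => x j - L) s = poissonMix x s - L := by
    rw [poissonMix_sub hx (.const L), poissonMix_const]
  exact tendsto_sub_nhds_zero_iff.1 (h.congr hmix)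

theorem PoissonSummable.of_tendsto {L : ℝ} (hL : Tendsto x atTop (𝓝 L)) : PoissonSummable x := by
  obtain ⟨C, hC⟩ := (Metric.isBounded_range_of_tendsto x hL).exists_norm_le
  exact .of_bounded fun j => hC _ (Set.mem_range_self j)

end PoissonMix

/-- The indicator function of `{n | m < n}`, whose increments are those of a unit jump at `m`. -/
noncomputable def tailInd (m : ℕ) : ℕ → ℝ :=
  (Set.Ioi m).indicator 1

theorem tailInd_nonneg (m : ℕ) : 0 ≤ tailInd m :=
  Set.indicator_nonneg fun _ _ => zero_le_one

theorem tailInd_le_one (m n : ℕ) : tailInd m n ≤ 1 :=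
  Set.indicator_le_self' (fun _ _ => zero_le_one) n

theorem tailInd_succ_sub (m n : ℕ) :
    tailInd m (n + 1) - tailInd m n = (Pi.single m 1 : ℕ → ℝ) n := by
  simp only [tailInd, Set.indicator_apply, Set.mem_Ioi, Pi.one_apply, Pi.single_apply]
  split_ifs <;> first | omega | simp

theorem fwdDiff_tailInd (m : ℕ) : fwdDiff 1 (tailInd m) = Pi.single m 1 :=
  funext (tailInd_succ_sub m)

theorem monotone_tailInd (m : ℕ) : Monotone (tailInd m) :=
  monotone_nat_of_le_succ fun n => by
    have hsingle : (0 : ℕ → ℝ) ≤ Pi.single m 1 := Pi.single_nonneg.2 zero_le_one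
    rw [← sub_nonneg, tailInd_succ_sub]
    exact hsingle n

/-- The tridiagonal operator with diagonal `a`, constant upper diagonal `p` and lower diagonal `q`.
The entry `q 0` acts on the junk index `0 - 1 = 0`: it should vanish. -/
def tridiag (a : ℕ → ℝ) (p : ℝ) (q : ℕ → ℝ) : (ℕ → ℝ) →ₗ[ℝ] (ℕ → ℝ) where
  toFun u n := a n * u n + p * u (n + 1) + q n * u (n - 1)
  map_add' u v := by ext n; simp only [Pi.add_apply]; ring
  map_smul' c u := by ext n; simp only [Pi.smul_apply, smul_eq_mul, RingHom.id_apply]; ring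

section tridiag

variable {a : ℕ → ℝ} {p : ℝ} {q : ℕ → ℝ}

theorem tridiag_apply (u : ℕ → ℝ) (n : ℕ) :
    tridiag a p q u n = a n * u n + p * u (n + 1) + q n * u (n - 1) :=
  rfl

theorem tridiag_pow_succ (j : ℕ) (u : ℕ → ℝ) (n : ℕ) :
    (tridiag a p q ^ (j + 1)) u n = a n * (tridiag a p q ^ j) u n
      + p * (tridiag a p q ^ j) u (n + 1) + q n * (tridiag a p q ^ j) u (n - 1) := by
  rw [pow_succ', Module.End.mul_apply, tridiag_apply]

theorem tridiag_pow_nonneg (ha : ∀ n, 0 ≤ a n) (hp : 0 ≤ p) (hq : ∀ n, 0 ≤ q n) (j : ℕ)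
    {u : ℕ → ℝ} (hu : 0 ≤ u) (n : ℕ) : 0 ≤ (tridiag a p q ^ j) u n := by
  induction j generalizing n with
  | zero => exact hu n
  | succ j ih =>
    rw [tridiag_pow_succ]
    exact add_nonneg (add_nonneg (mul_nonneg (ha n) (ih n)) (mul_nonneg hp (ih _)))
      (mul_nonneg (hq n) (ih _))

theorem hasSum_tridiag_pow_single_mul (j : ℕ) (u : ℕ → ℝ) (n : ℕ) :
    HasSum (fun m => (tridiag a p q ^ j) (Pi.single m 1) n * u m) ((tridiag a p q ^ j) u n) := by
  induction j generalizing n with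
  | zero =>
    have h := hasSum_single (f := fun m => (Pi.single m 1 : ℕ → ℝ) n * u m) n fun m hm => by
      rw [Pi.single_eq_of_ne' hm, zero_mul]
    rwa [Pi.single_eq_same, one_mul] at h
  | succ j ih =>
    simp only [tridiag_pow_succ, add_mul, mul_assoc]
    exact (((ih n).mul_left _).add ((ih _).mul_left _)).add ((ih _).mul_left _)

theorem tridiag_single_zero (hq : q 0 = 0) :
    tridiag a p q (Pi.single 0 1) = a 0 • Pi.single 0 (1 : ℝ) + q 1 • Pi.single 1 (1 : ℝ) := by
  ext n
  rw [tridiag_apply]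
  rcases n with _ | _ | n <;> simp [hq]

theorem tridiag_single_succ (m : ℕ) :
    tridiag a p q (Pi.single (m + 1) 1) = a (m + 1) • Pi.single (m + 1) (1 : ℝ)
      + p • Pi.single m (1 : ℝ) + q (m + 2) • Pi.single (m + 2) (1 : ℝ) := by
  ext n
  have h1 : n + 1 = m + 1 ↔ n = m := by omega
  have h2 : n - 1 = m + 1 ↔ n = m + 2 := by omega
  simp only [tridiag_apply, Pi.add_apply, Pi.smul_apply, Pi.single_apply, smul_eq_mul, mul_ite,
    mul_one, mul_zero, h1, h2]
  split_ifs <;> simp_all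

theorem tridiag_pow_symm (hq : q 0 = 0) {w : ℕ → ℝ}
    (hw : ∀ n, p * w n = q (n + 1) * w (n + 1)) (j n m : ℕ) :
    w n * (tridiag a p q ^ j) (Pi.single m 1) n
      = w m * (tridiag a p q ^ j) (Pi.single n 1) m := by
  induction j generalizing n m with
  | zero =>
    rcases eq_or_ne n m with rfl | h
    · rfl
    · simp [h, h.symm]
  | succ j ih =>
    rw [tridiag_pow_succ, pow_succ, Module.End.mul_apply]
    rcases n with _ | n
    · simp only [tridiag_single_zero hq, map_add, map_smul, Pi.add_apply, Pi.smul_apply,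
        smul_eq_mul, hq]
      linear_combination a 0 * ih 0 m + q 1 * ih 1 m
        + (tridiag a p q ^ j) (Pi.single m 1) 1 * hw 0
    · simp only [tridiag_single_succ, map_add, map_smul, Pi.add_apply, Pi.smul_apply, smul_eq_mul,
        Nat.add_sub_cancel]
      linear_combination a (n + 1) * ih (n + 1) m + q (n + 2) * ih (n + 2) m + p * ih n m
        + (tridiag a p q ^ j) (Pi.single m 1) (n + 2) * hw (n + 1)
        - (tridiag a p q ^ j) (Pi.single m 1) n * hw n

end tridiag

/-- A random walk on `ℕ` with constant up-probability `p` and down-probabilities `q n`. -/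
structure BirthDeathWalk where
  p : ℝ
  q : ℕ → ℝ
  p_pos : 0 < p
  q_nonneg : ∀ n, 0 ≤ q n
  q_zero : q 0 = 0
  add_le_one : ∀ n, p + q n ≤ 1

namespace BirthDeathWalk

variable (W : BirthDeathWalk)

/-- The transition operator of the walk. -/
def trans : (ℕ → ℝ) →ₗ[ℝ] (ℕ → ℝ) :=
  tridiag (fun n => 1 - W.p - W.q n) W.p W.q

/-- The operator induced by `trans` on increments: it is substochastic and, if the walk is
positive recurrent, transient. -/
def dual : (ℕ → ℝ) →ₗ[ℝ] (ℕ → ℝ) :=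
  tridiag (fun n => 1 - W.p - W.q (n + 1)) W.p W.q

theorem trans_pow_nonneg (j : ℕ) {u : ℕ → ℝ} (hu : 0 ≤ u) (n : ℕ) :
    0 ≤ (W.trans ^ j) u n :=
  tridiag_pow_nonneg (fun n => by linarith [W.add_le_one n]) W.p_pos.le W.q_nonneg j hu n

theorem dual_pow_nonneg (j : ℕ) {u : ℕ → ℝ} (hu : 0 ≤ u) (n : ℕ) :
    0 ≤ (W.dual ^ j) u n :=
  tridiag_pow_nonneg (fun n => by linarith [W.add_le_one (n + 1)]) W.p_pos.le W.q_nonneg j hu n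

theorem trans_apply (u : ℕ → ℝ) (n : ℕ) :
    W.trans u n = u n + W.p * (u (n + 1) - u n) - W.q n * (u n - u (n - 1)) := by
  rw [trans, tridiag_apply]
  ring

theorem trans_pow_succ (j : ℕ) (u : ℕ → ℝ) (n : ℕ) :
    (W.trans ^ (j + 1)) u n = (W.trans ^ j) u n
      + W.p * ((W.trans ^ j) u (n + 1) - (W.trans ^ j) u n)
      - W.q n * ((W.trans ^ j) u n - (W.trans ^ j) u (n - 1)) := by
  rw [pow_succ', Module.End.mul_apply, trans_apply]

theorem trans_pow_const (j : ℕ) (b : ℝ) (n : ℕ) : (W.trans ^ j) (fun _ => b) n = b := by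
  induction j generalizing n with
  | zero => rfl
  | succ j ih => rw [trans_pow_succ, ih, ih, ih]; ring

theorem trans_pow_le {C : ℝ} (j : ℕ) {u : ℕ → ℝ} (hu : ∀ n, u n ≤ C) (n : ℕ) :
    (W.trans ^ j) u n ≤ C := by
  have h := W.trans_pow_nonneg j (u := (fun _ => C) - u) (fun n => sub_nonneg.2 (hu n)) n
  rwa [map_sub, Pi.sub_apply, trans_pow_const, sub_nonneg] at h

theorem poissonSummable_trans_pow {C : ℝ} {u : ℕ → ℝ} (hu : 0 ≤ u) (huC : ∀ n, u n ≤ C) (n : ℕ) :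
    PoissonSummable fun j => (W.trans ^ j) u n :=
  .of_bounded fun j => by
    rw [abs_of_nonneg (W.trans_pow_nonneg j hu n)]
    exact W.trans_pow_le j huC n

theorem poissonSummable_trans_pow_single (n m : ℕ) :
    PoissonSummable fun j => (W.trans ^ j) (Pi.single m 1) n :=
  W.poissonSummable_trans_pow (C := 1) (Pi.single_nonneg.2 zero_le_one)
    (fun i => (Pi.single_apply m (1 : ℝ) i).trans_le (ite_le_one le_rfl zero_le_one)) n

theorem trans_tailInd (m : ℕ) :
    W.trans (tailInd m)
      = tailInd m + W.p • Pi.single m 1 - W.q (m + 1) • Pi.single (m + 1) 1 := by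
  ext n
  rw [trans_apply, tailInd_succ_sub]
  rcases n with _ | n
  · simp [W.q_zero]
  · rw [Nat.add_sub_cancel, tailInd_succ_sub]
    rcases eq_or_ne n m with rfl | h
    · simp
    · simp [h]

theorem fwdDiff_trans_pow (j : ℕ) (u : ℕ → ℝ) :
    fwdDiff 1 ((W.trans ^ j) u) = (W.dual ^ j) (fwdDiff 1 u) := by
  induction j with
  | zero => rfl
  | succ j ih =>
    rw [pow_succ' W.dual, Module.End.mul_apply, ← ih]
    ext n
    rw [dual, tridiag_apply]
    simp only [fwdDiff, trans_pow_succ]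
    rcases n with _ | n
    · simp only [W.q_zero, zero_add]; ring
    · simp only [Nat.add_sub_cancel]; ring

theorem sum_dual_pow_single_le_one (n j N : ℕ) :
    ∑ m ∈ Finset.range N, (W.dual ^ j) (Pi.single n 1) m ≤ 1 := by
  rw [← fwdDiff_tailInd, ← fwdDiff_trans_pow]
  simp only [fwdDiff, Finset.sum_range_sub]
  linarith [W.trans_pow_le j (tailInd_le_one n) N, W.trans_pow_nonneg j (tailInd_nonneg n) 0]

/-- A positive probability distribution in detailed balance with the walk. -/
structure IsReversible (w : ℕ → ℝ) : Prop where
  pos : ∀ n, 0 < w n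
  hasSum : HasSum w 1
  balance : ∀ n, W.p * w n = W.q (n + 1) * w (n + 1)

/-- Increments of the solution of the Poisson equation `g - trans g = f - η`. -/
noncomputable def poissonInc (w f : ℕ → ℝ) (η : ℝ) (n : ℕ) : ℝ :=
  (∑ i ∈ Finset.range (n + 1), w i * (η - f i)) / (W.p * w n)

/-- The solution of the Poisson equation `g - trans g = f - η` vanishing at `0`. -/
noncomputable def poissonSol (w f : ℕ → ℝ) (η : ℝ) (n : ℕ) : ℝ :=
  ∑ i ∈ Finset.range n, W.poissonInc w f η i

variable {W} {w f : ℕ → ℝ} {η : ℝ}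

namespace IsReversible

theorem poissonInc_zero (hw : W.IsReversible w) : W.p * W.poissonInc w f η 0 = η - f 0 := by
  have hw0 := (hw.pos 0).ne'
  have hp := W.p_pos.ne'
  simp only [poissonInc, zero_add, Finset.range_one, Finset.sum_singleton]
  field_simp

theorem poissonInc_succ (hw : W.IsReversible w) (n : ℕ) :
    W.p * W.poissonInc w f η (n + 1) - W.q (n + 1) * W.poissonInc w f η n = η - f (n + 1) := by
  have hwn := (hw.pos n).ne'
  have hwn' := (hw.pos (n + 1)).ne'
  have hp := W.p_pos.ne'
  have hq : W.q (n + 1) = W.p * w n / w (n + 1) :=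
    (eq_div_iff hwn').2 (hw.balance n).symm
  rw [poissonInc, poissonInc, hq, Finset.sum_range_succ _ (n + 1)]
  field_simp
  ring

theorem poissonInc_eq (hw : W.IsReversible w) (n : ℕ) :
    W.p * W.poissonInc w f η n - W.q n * W.poissonInc w f η (n - 1) = η - f n := by
  rcases n with _ | n
  · rw [W.q_zero, hw.poissonInc_zero, zero_mul, sub_zero]
  · exact hw.poissonInc_succ n

theorem dual_poissonInc (hw : W.IsReversible w) :
    W.dual (W.poissonInc w f η) = W.poissonInc w f η - fwdDiff 1 f := by
  ext n
  rw [dual, tridiag_apply, Pi.sub_apply, fwdDiff]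
  linarith [hw.poissonInc_eq (f := f) (η := η) n, hw.poissonInc_succ (f := f) (η := η) n]

theorem sum_dual_pow_fwdDiff (hw : W.IsReversible w) (j : ℕ) :
    ∑ i ∈ Finset.range j, (W.dual ^ i) (fwdDiff 1 f)
      = W.poissonInc w f η - (W.dual ^ j) (W.poissonInc w f η) := by
  induction j with
  | zero => simp
  | succ j ih =>
    rw [Finset.sum_range_succ, ih, pow_succ, Module.End.mul_apply, hw.dual_poissonInc, map_sub]
    abel

theorem hasSum_mul_sub (hw : W.IsReversible w) (hf : HasSum (fun n => w n * f n) η) :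
    HasSum (fun n => w n * (η - f n)) 0 := by
  simpa only [mul_sub, one_mul, sub_self] using (hw.hasSum.mul_right η).sub hf

theorem poissonInc_nonneg (hw : W.IsReversible w) (hf_mono : Monotone f)
    (hf : HasSum (fun n => w n * f n) η) (n : ℕ) : 0 ≤ W.poissonInc w f η n := by
  refine div_nonneg ?_ (mul_nonneg W.p_pos.le (hw.pos n).le)
  rcases le_or_gt (f n) η with hfn | hfn
  · exact Finset.sum_nonneg fun i hi => mul_nonneg (hw.pos i).le
      (sub_nonneg.2 ((hf_mono (Finset.mem_range_succ_iff.1 hi)).trans hfn))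
  · have h := sum_le_hasSum (Finset.range (n + 1)) (fun i hi => ?_) (hw.hasSum_mul_sub hf).neg
    · simpa using h
    · rw [Finset.mem_range_succ_iff, not_le] at hi
      exact neg_nonneg.2 (mul_nonpos_of_nonneg_of_nonpos (hw.pos i).le
        (sub_nonpos.2 (hfn.le.trans (hf_mono hi.le))))

theorem tendsto_dual_pow_single (hw : W.IsReversible w) (n m : ℕ) :
    Tendsto (fun j => (W.dual ^ j) (Pi.single n 1) m) atTop (𝓝 0) := by
  obtain ⟨η, hη⟩ : Summable fun i => w i * tailInd n i :=
    hw.hasSum.summable.of_nonneg_of_le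
      (fun i => mul_nonneg (hw.pos i).le (tailInd_nonneg n i))
      fun i => mul_le_of_le_one_right (hw.pos i).le (tailInd_le_one n i)
  have hG := hw.poissonInc_nonneg (monotone_tailInd n) hη
  refine Summable.tendsto_atTop_zero (summable_of_sum_range_le
    (c := W.poissonInc w (tailInd n) η m)
    (fun j => W.dual_pow_nonneg j (Pi.single_nonneg.2 zero_le_one) m) fun j => ?_)
  have h := congrFun (hw.sum_dual_pow_fwdDiff (f := tailInd n) (η := η) j) m
  rw [fwdDiff_tailInd, Finset.sum_apply, Pi.sub_apply] at h
  exact h.trans_le (sub_le_self _ (W.dual_pow_nonneg j hG m))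

theorem dual_pow_poissonInc (hw : W.IsReversible w) (j m : ℕ) :
    (W.dual ^ j) (W.poissonInc w f η) m
      = (∑' n, (W.dual ^ j) (Pi.single m 1) n * ∑ i ∈ Finset.range (n + 1), w i * (η - f i))
        * (W.p * w m)⁻¹ := by
  rw [← tsum_mul_right, dual, ← (hasSum_tridiag_pow_single_mul j _ m).tsum_eq]
  refine tsum_congr fun n => ?_
  have hsymm := tridiag_pow_symm (a := fun n => 1 - W.p - W.q (n + 1)) W.q_zero hw.balance j m n
  have hn := (hw.pos n).ne'
  have hm := (hw.pos m).ne'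
  have hp := W.p_pos.ne'
  rw [poissonInc]
  field_simp
  linear_combination (∑ i ∈ Finset.range (n + 1), w i * (η - f i)) * hsymm

theorem tendsto_dual_pow_poissonInc (hw : W.IsReversible w)
    (hf : HasSum (fun n => w n * f n) η) (m : ℕ) :
    Tendsto (fun j => (W.dual ^ j) (W.poissonInc w f η) m) atTop (𝓝 0) := by
  have hsum : Tendsto (fun n => ∑ i ∈ Finset.range (n + 1), w i * (η - f i)) atTop (𝓝 0) :=
    (hw.hasSum_mul_sub hf).tendsto_sum_nat.comp (tendsto_add_atTop_nat 1)
  have h := tendsto_tsum_mul_of_tendsto_zero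
    (.of_forall fun j => W.dual_pow_nonneg j (Pi.single_nonneg.2 zero_le_one))
    (.of_forall fun j N => W.sum_dual_pow_single_le_one m j N) (hw.tendsto_dual_pow_single m) hsum
  simpa only [hw.dual_pow_poissonInc, zero_mul] using h.mul_const (W.p * w m)⁻¹

theorem trans_poissonSol (hw : W.IsReversible w) :
    W.trans (W.poissonSol w f η) = W.poissonSol w f η + ((fun _ => η) - f) := by
  have hdiff (n : ℕ) : W.poissonSol w f η (n + 1) - W.poissonSol w f η n = W.poissonInc w f η n :=
    Finset.sum_range_succ_sub_sum _
  ext n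
  rw [trans_apply, hdiff, Pi.add_apply, Pi.sub_apply]
  have h := hw.poissonInc_eq (f := f) (η := η) n
  rcases n with _ | n
  · rw [W.q_zero] at h ⊢
    linarith
  · rw [Nat.add_sub_cancel] at h ⊢
    rw [hdiff]
    linarith

theorem tendsto_trans_pow_poissonSol_sub (hw : W.IsReversible w)
    (hf : HasSum (fun n => w n * f n) η) (n : ℕ) :
    Tendsto (fun j => (W.trans ^ j) (W.poissonSol w f η) n - (W.trans ^ j) (W.poissonSol w f η) 0)
      atTop (𝓝 0) := by
  have hdiff : fwdDiff 1 (W.poissonSol w f η) = W.poissonInc w f η :=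
    funext fun n => Finset.sum_range_succ_sub_sum _
  have h := tendsto_finsetSum (Finset.range n) fun i _ => hw.tendsto_dual_pow_poissonInc hf i
  simpa only [← hdiff, ← fwdDiff_trans_pow, fwdDiff, Finset.sum_range_sub,
    Finset.sum_const_zero] using h

theorem trans_pow_succ_poissonSol (hw : W.IsReversible w) (j n : ℕ) :
    (W.trans ^ (j + 1)) (W.poissonSol w f η) n
      = (W.trans ^ j) (W.poissonSol w f η) n + (η - (W.trans ^ j) f n) := by
  rw [pow_succ, Module.End.mul_apply, hw.trans_poissonSol, map_add, map_sub, Pi.add_apply,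
    Pi.sub_apply, trans_pow_const]

/-- The mean ergodic theorem holds pointwise, and for unbounded `f`. -/
theorem tendsto_trans_pow (hw : W.IsReversible w)
    (hf : HasSum (fun n => w n * f n) η) (n : ℕ) :
    Tendsto (fun j => (W.trans ^ j) f n) atTop (𝓝 η) := by
  set g := W.poissonSol w f η
  have hf_eq (j : ℕ) : η
      - (W.p * (((W.trans ^ j) g (n + 1) - (W.trans ^ j) g 0)
          - ((W.trans ^ j) g n - (W.trans ^ j) g 0))
        - W.q n * (((W.trans ^ j) g n - (W.trans ^ j) g 0)
          - ((W.trans ^ j) g (n - 1) - (W.trans ^ j) g 0))) = (W.trans ^ j) f n := by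
    linarith [hw.trans_pow_succ_poissonSol (f := f) (η := η) j n, W.trans_pow_succ j g n]
  have hlim := hw.tendsto_trans_pow_poissonSol_sub hf
  have h := (tendsto_const_nhds (x := η)).sub
    ((((hlim (n + 1)).sub (hlim n)).const_mul W.p).sub
      (((hlim n).sub (hlim (n - 1))).const_mul (W.q n)))
  simp only [sub_zero, mul_zero] at h
  exact h.congr hf_eq

end IsReversible

end BirthDeathWalk

namespace GroupServerQueue

section Uniformization

variable {K : ℕ} {Q : GroupServerQueue K} {d : ℕ → Fin K → ℕ}

theorem rate_nonneg (Q : GroupServerQueue K) (d : ℕ → Fin K → ℕ) (n : ℕ) : 0 ≤ Q.rate d n :=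
  Finset.sum_nonneg fun k _ => mul_nonneg (Nat.cast_nonneg _) (Q.mu_pos k).le

theorem unifRate_pos (Q : GroupServerQueue K) : 0 < Q.unifRate :=
  add_pos_of_pos_of_nonneg Q.lam_pos <|
    Finset.sum_nonneg fun k _ => mul_nonneg (Nat.cast_nonneg _) (Q.mu_pos k).le

theorem IsEfficient.rate_le (hd : Q.IsEfficient d) (n : ℕ) :
    Q.rate d n ≤ ∑ k, (Q.M k : ℝ) * Q.mu k :=
  Finset.sum_le_sum fun k _ =>
    mul_le_mul_of_nonneg_right (Nat.cast_le.2 ((hd n).1 k)) (Q.mu_pos k).le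

theorem IsEfficient.zero (hd : Q.IsEfficient d) (k : Fin K) : d 0 k = 0 :=
  Finset.sum_eq_zero_iff.1 (Nat.le_zero.1 (hd 0).2) k (Finset.mem_univ k)

theorem IsEfficient.rate_zero (hd : Q.IsEfficient d) : Q.rate d 0 = 0 :=
  Finset.sum_eq_zero fun k _ => by rw [hd.zero k, Nat.cast_zero, zero_mul]

theorem h_le_cost (Q : GroupServerQueue K) (d : ℕ → Fin K → ℕ) (n : ℕ) : Q.h n ≤ Q.cost d n :=
  le_add_of_nonneg_right <|
    Finset.sum_nonneg fun k _ => mul_nonneg (Nat.cast_nonneg _) (Q.c_nonneg k)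

theorem h_zero_le_cost (Q : GroupServerQueue K) (d : ℕ → Fin K → ℕ) (n : ℕ) :
    Q.h 0 ≤ Q.cost d n :=
  (Q.h_mono (Nat.zero_le n)).trans (Q.h_le_cost d n)

/-- The uniformized jump chain. -/
noncomputable def walk (hd : Q.IsEfficient d) : BirthDeathWalk where
  p := Q.lam / Q.unifRate
  q n := Q.rate d n / Q.unifRate
  p_pos := div_pos Q.lam_pos Q.unifRate_pos
  q_nonneg n := div_nonneg (Q.rate_nonneg d n) Q.unifRate_pos.le
  q_zero := by rw [hd.rate_zero, zero_div]
  add_le_one n := by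
    rw [← add_div, div_le_one Q.unifRate_pos]
    exact add_le_add_right (hd.rate_le n) Q.lam

theorem unifRate_mul_walk_p (hd : Q.IsEfficient d) : Q.unifRate * (walk hd).p = Q.lam :=
  mul_div_cancel₀ _ Q.unifRate_pos.ne'

theorem unifRate_mul_walk_q (hd : Q.IsEfficient d) (n : ℕ) :
    Q.unifRate * (walk hd).q n = Q.rate d n :=
  mul_div_cancel₀ _ Q.unifRate_pos.ne'

theorem tsum_gen_mul (hd : Q.IsEfficient d) (u : ℕ → ℝ) (n : ℕ) :
    ∑' i, ((if n = i then 1 else 0) + Q.gen d n i / Q.unifRate) * u i = (walk hd).trans u n := by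
  rw [BirthDeathWalk.trans_apply, tsum_eq_sum (s := {n - 1, n, n + 1}) fun i hi => ?_]
  · simp only [walk]
    rcases n with _ | n
    · simp only [zero_tsub, zero_add, Finset.mem_insert, Finset.mem_singleton, zero_ne_one,
        or_false, Finset.insert_eq_of_mem, gen, Nat.add_eq_zero_iff, one_ne_zero, and_false,
        ↓reduceIte, hd.rate_zero, add_zero, not_false_eq_true, Finset.sum_insert,
        Finset.sum_singleton, zero_div, sub_self, mul_zero, sub_zero]
      ring
    · have hne : n ≠ n + 1 + 1 := by omega
      rw [Nat.add_sub_cancel, Finset.sum_insert (by simp [hne]), Finset.sum_pair (by simp)]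
      simp only [Nat.add_eq_left, one_ne_zero, ↓reduceIte, gen, hne, zero_add,
        Nat.left_eq_add, neg_add_rev]
      ring
  · simp only [Finset.mem_insert, Finset.mem_singleton, not_or] at hi
    have hgen : Q.gen d n i = 0 := by
      rw [gen, if_neg hi.2.2, if_neg (by omega), if_neg hi.2.1]
    rw [if_neg (Ne.symm hi.2.1), hgen, zero_div, add_zero, zero_mul]

theorem jumpProb_eq (hd : Q.IsEfficient d) (j n m : ℕ) :
    Q.jumpProb d j n m = ((walk hd).trans ^ j) (Pi.single m 1) n := by
  induction j generalizing n with
  | zero => rw [jumpProb, pow_zero, Module.End.one_apply, Pi.single_apply]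
  | succ j ih =>
    simp only [jumpProb, ih]
    rw [tsum_gen_mul hd, pow_succ', Module.End.mul_apply]

theorem transProb_eq (hd : Q.IsEfficient d) (t : ℝ) (n m : ℕ) :
    Q.transProb d t n m
      = poissonMix (fun j => ((walk hd).trans ^ j) (Pi.single m 1) n) (Q.unifRate * t) := by
  simp only [transProb, jumpProb_eq hd, poissonMix]

theorem transProb_nonneg (hd : Q.IsEfficient d) {t : ℝ} (ht : 0 ≤ t) (n m : ℕ) :
    0 ≤ Q.transProb d t n m := by
  rw [transProb_eq hd]
  exact poissonMix_nonneg
    (fun j => (walk hd).trans_pow_nonneg j (Pi.single_nonneg.2 zero_le_one) n)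
    (mul_nonneg Q.unifRate_pos.le ht)

theorem continuous_transProb (hd : Q.IsEfficient d) (n m : ℕ) :
    Continuous fun t => Q.transProb d t n m := by
  simp only [transProb_eq hd]
  exact ((walk hd).poissonSummable_trans_pow_single n m).continuous.comp
    (continuous_const.mul continuous_id)

theorem hasSum_transProb_mul_iff_of_nonneg (hd : Q.IsEfficient d) {u : ℕ → ℝ} (hu : 0 ≤ u)
    {t : ℝ} (ht : 0 ≤ t) (n : ℕ) {x : ℝ} :
    HasSum (fun m => Q.transProb d t n m * u m) x ↔
      HasSum (fun j : ℕ => Real.exp (-(Q.unifRate * t)) * (Q.unifRate * t) ^ j / j !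
        * ((walk hd).trans ^ j) u n) x := by
  have hs : 0 ≤ Q.unifRate * t := mul_nonneg Q.unifRate_pos.le ht
  set s := Q.unifRate * t
  set F : ℕ → ℕ → ℝ := fun j m =>
    Real.exp (-s) * s ^ j / j ! * (((walk hd).trans ^ j) (Pi.single m 1) n * u m)
  have hF (j m : ℕ) : 0 ≤ F j m := mul_nonneg (by positivity) <|
    mul_nonneg ((walk hd).trans_pow_nonneg j (Pi.single_nonneg.2 zero_le_one) n) (hu m)
  have hrow (j : ℕ) :
      HasSum (F j) (Real.exp (-s) * s ^ j / j ! * ((walk hd).trans ^ j) u n) :=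
    (hasSum_tridiag_pow_single_mul j u n).mul_left _
  have hcol (m : ℕ) : HasSum (F · m) (Q.transProb d t n m * u m) := by
    simp only [F, ← mul_assoc, transProb_eq hd]
    exact (((walk hd).poissonSummable_trans_pow_single n m).summable s).hasSum.mul_right _
  exact ⟨hasSum_cols_of_hasSum_rows (fun m j => hF j m) hcol hrow,
    hasSum_cols_of_hasSum_rows hF hrow hcol⟩

theorem hasSum_transProb (hd : Q.IsEfficient d) {t : ℝ} (ht : 0 ≤ t) (n : ℕ) :
    HasSum (Q.transProb d t n) 1 := by
  simpa only [BirthDeathWalk.trans_pow_const, mul_one, hasSum_poissonWeight, iff_true] using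
    hasSum_transProb_mul_iff_of_nonneg hd (u := fun _ => 1) (fun _ => zero_le_one) ht n (x := 1)

theorem hasSum_transProb_mul_iff (hd : Q.IsEfficient d) {u : ℕ → ℝ} {b : ℝ} (hu : ∀ m, b ≤ u m)
    {t : ℝ} (ht : 0 ≤ t) (n : ℕ) {x : ℝ} :
    HasSum (fun m => Q.transProb d t n m * u m) x ↔
      HasSum (fun j : ℕ => Real.exp (-(Q.unifRate * t)) * (Q.unifRate * t) ^ j / j !
        * ((walk hd).trans ^ j) u n) x := by
  have h := hasSum_transProb_mul_iff_of_nonneg hd (u := u - fun _ => b)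
    (fun m => sub_nonneg.2 (hu m)) ht n (x := x - b)
  simp only [map_sub, Pi.sub_apply, BirthDeathWalk.trans_pow_const] at h
  rwa [hasSum_mul_sub_const_iff (hasSum_transProb hd ht n),
    hasSum_mul_sub_const_iff (hasSum_poissonWeight _)] at h

/-- The expected cost rate after `j` jumps of the uniformized chain, started at `n`. -/
noncomputable def jumpCost (hd : Q.IsEfficient d) (n j : ℕ) : ℝ :=
  ((walk hd).trans ^ j) (Q.cost d) n

theorem poissonSummable_jumpCost (hd : Q.IsEfficient d) {n : ℕ}
    (h : ∀ t, 0 ≤ t → Summable fun m => Q.transProb d t n m * Q.cost d m) :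
    PoissonSummable (jumpCost hd n) :=
  .of_nonneg fun s hs => by
    have hL := Q.unifRate_pos
    have ht : 0 ≤ s / Q.unifRate := div_nonneg hs hL.le
    obtain ⟨x, hx⟩ := h _ ht
    rw [hasSum_transProb_mul_iff hd (Q.h_zero_le_cost d) ht, mul_div_cancel₀ _ hL.ne'] at hx
    exact hx.summable

theorem hasSum_transProb_mul_cost (hd : Q.IsEfficient d) {n : ℕ}
    (h : PoissonSummable (jumpCost hd n)) {t : ℝ} (ht : 0 ≤ t) :
    HasSum (fun m => Q.transProb d t n m * Q.cost d m)
      (poissonMix (jumpCost hd n) (Q.unifRate * t)) :=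
  (hasSum_transProb_mul_iff hd (Q.h_zero_le_cost d) ht n).2 (h.summable _).hasSum

theorem expCost_eq (hd : Q.IsEfficient d) {n : ℕ} (h : PoissonSummable (jumpCost hd n)) {t : ℝ}
    (ht : 0 ≤ t) : Q.expCost d t n = poissonMix (jumpCost hd n) (Q.unifRate * t) :=
  (hasSum_transProb_mul_cost hd h ht).tsum_eq

theorem intervalIntegrable_poissonMix_unifRate (Q : GroupServerQueue K) {x : ℕ → ℝ}
    (hx : PoissonSummable x) (T : ℝ) :
    IntervalIntegrable (fun t => poissonMix x (Q.unifRate * t)) volume 0 T :=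
  (hx.continuous.comp (continuous_const.mul continuous_id)).intervalIntegrable 0 T

theorem intervalIntegrable_expCost (hd : Q.IsEfficient d) {n : ℕ}
    (h : PoissonSummable (jumpCost hd n)) {T : ℝ} (hT : 0 ≤ T) :
    IntervalIntegrable (Q.expCost d · n) volume 0 T := by
  refine (Q.intervalIntegrable_poissonMix_unifRate h T).congr fun t ht => ?_
  rw [Set.uIoc_of_le hT] at ht
  exact (expCost_eq hd h ht.1.le).symm

theorem integral_expCost_sub_sub (hd : Q.IsEfficient d) {n m : ℕ}
    (hn : PoissonSummable (jumpCost hd n)) (hm : PoissonSummable (jumpCost hd m)) (η : ℝ) {T : ℝ}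
    (hT : 0 ≤ T) :
    (∫ t in (0 : ℝ)..T, (Q.expCost d t n - η)) - ∫ t in (0 : ℝ)..T, (Q.expCost d t m - η)
      = ∫ t in (0 : ℝ)..T,
          poissonMix (fun j => jumpCost hd n j - jumpCost hd m j) (Q.unifRate * t) := by
  rw [← intervalIntegral.integral_sub
    ((intervalIntegrable_expCost hd hn hT).sub intervalIntegrable_const)
    ((intervalIntegrable_expCost hd hm hT).sub intervalIntegrable_const)]
  refine intervalIntegral.integral_congr fun t ht => ?_
  rw [Set.uIcc_of_le hT] at ht
  simp only [poissonMix_sub hn hm, expCost_eq hd hn ht.1, expCost_eq hd hm ht.1,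
    sub_sub_sub_cancel_right]

end Uniformization

section Occupation

variable {K : ℕ} {Q : GroupServerQueue K} {d : ℕ → Fin K → ℕ} {η : ℝ}

/-- Expected fraction of the time interval `[0, T]` spent in state `m`, starting from `0`. -/
noncomputable def occupation (Q : GroupServerQueue K) (d : ℕ → Fin K → ℕ) (T : ℝ) (m : ℕ) : ℝ :=
  (1 / T) * ∫ t in (0 : ℝ)..T, Q.transProb d t 0 m

theorem occupation_nonneg (hd : Q.IsEfficient d) {T : ℝ} (hT : 0 ≤ T) (m : ℕ) :
    0 ≤ Q.occupation d T m :=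
  mul_nonneg (one_div_nonneg.2 hT) <|
    intervalIntegral.integral_nonneg hT fun _ ht => transProb_nonneg hd ht.1 0 m

theorem sum_occupation_mul_le (hd : Q.IsEfficient d) {S : Finset ℕ} {u : ℕ → ℝ} {F : ℝ → ℝ} {T : ℝ}
    (hT : 0 ≤ T) (hF : IntervalIntegrable F volume 0 T)
    (h : ∀ t, 0 ≤ t → ∑ m ∈ S, Q.transProb d t 0 m * u m ≤ F t) :
    ∑ m ∈ S, Q.occupation d T m * u m ≤ (1 / T) * ∫ t in (0 : ℝ)..T, F t := by
  have hcont (m : ℕ) : Continuous fun t => Q.transProb d t 0 m * u m :=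
    (continuous_transProb hd 0 m).mul continuous_const
  calc ∑ m ∈ S, Q.occupation d T m * u m
      = (1 / T) * ∫ t in (0 : ℝ)..T, ∑ m ∈ S, Q.transProb d t 0 m * u m := by
        rw [intervalIntegral.integral_finsetSum fun m _ => (hcont m).intervalIntegrable 0 T,
          Finset.mul_sum]
        simp only [occupation, intervalIntegral.integral_mul_const, mul_assoc]
    _ ≤ (1 / T) * ∫ t in (0 : ℝ)..T, F t :=
        mul_le_mul_of_nonneg_left
          (intervalIntegral.integral_mono_on hT
            ((continuous_finsetSum S fun m _ => hcont m).intervalIntegrable 0 T) hF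
            fun t ht => h t ht.1)
          (one_div_nonneg.2 hT)

theorem sum_occupation_le_one (hd : Q.IsEfficient d) {T : ℝ} (hT : 0 < T) (S : Finset ℕ) :
    ∑ m ∈ S, Q.occupation d T m ≤ 1 := by
  have h := sum_occupation_mul_le hd (S := S) (u := fun _ => 1) (F := fun _ => 1) hT.le
    intervalIntegrable_const fun t ht => by
      simpa only [mul_one] using
        sum_le_hasSum S (fun m _ => transProb_nonneg hd ht 0 m) (hasSum_transProb hd ht 0)
  rw [intervalIntegral.integral_const, smul_eq_mul, sub_zero, mul_one,
    one_div_mul_cancel hT.ne'] at h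
  simpa only [mul_one] using h

theorem sum_occupation_mul_cost_sub_le (hd : Q.IsEfficient d) (hη : Q.HasAverageCost d η)
    {S : Finset ℕ} {a : ℝ} (ha : ∀ m ∉ S, a ≤ Q.cost d m) {T : ℝ} (hT : 0 < T) :
    ∑ m ∈ S, Q.occupation d T m * (Q.cost d m - a)
      ≤ (1 / T) * (∫ t in (0 : ℝ)..T, Q.expCost d t 0) - a := by
  have hint := (hη 0).2.1 T hT.le
  refine (sum_occupation_mul_le hd hT.le (F := fun t => Q.expCost d t 0 - a)
    (hint.sub intervalIntegrable_const) fun t ht => ?_).trans_eq ?_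
  · exact sum_le_hasSum S
      (fun m hm => mul_nonneg (transProb_nonneg hd ht 0 m) (sub_nonneg.2 (ha m hm)))
      ((hasSum_mul_sub_const_iff (hasSum_transProb hd ht 0)).2 ((hη 0).1 t ht).hasSum)
  · rw [intervalIntegral.integral_sub hint intervalIntegrable_const,
      intervalIntegral.integral_const, smul_eq_mul, sub_zero, mul_sub, ← mul_assoc,
      one_div_mul_cancel hT.ne', one_mul]

theorem lam_mul_transProb_sub (hd : Q.IsEfficient d) (t : ℝ) (n m : ℕ) :
    Q.lam * Q.transProb d t n m - Q.rate d (m + 1) * Q.transProb d t n (m + 1)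
      = poissonMix (fun j => Q.unifRate * (((walk hd).trans ^ (j + 1)) (tailInd m) n
          - ((walk hd).trans ^ j) (tailInd m) n)) (Q.unifRate * t) := by
  have hsingle := (walk hd).poissonSummable_trans_pow_single n
  rw [transProb_eq hd, transProb_eq hd, ← poissonMix_const_mul, ← poissonMix_const_mul,
    ← poissonMix_sub ((hsingle m).const_mul _) ((hsingle (m + 1)).const_mul _)]
  congr 1
  ext j
  rw [pow_succ, Module.End.mul_apply, BirthDeathWalk.trans_tailInd, ← unifRate_mul_walk_p hd,
    ← unifRate_mul_walk_q hd]
  simp only [map_add, map_sub, map_smul, Pi.add_apply, Pi.sub_apply, Pi.smul_apply, smul_eq_mul]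
  ring

/-- Up to the factor `1 / T`, the net flow from `m` to `m + 1` until `T` is the probability of
being above `m` at `T`. -/
theorem lam_mul_occupation_sub_mem_Icc (hd : Q.IsEfficient d) {T : ℝ} (hT : 0 ≤ T) (m : ℕ) :
    Q.lam * Q.occupation d T m - Q.rate d (m + 1) * Q.occupation d T (m + 1)
      ∈ Set.Icc 0 (1 / T) := by
  have hint (m : ℕ) (b : ℝ) : IntervalIntegrable (fun t => b * Q.transProb d t 0 m) volume 0 T :=
    ((continuous_transProb hd 0 m).intervalIntegrable 0 T).const_mul b
  have hpos := (walk hd).trans_pow_nonneg (n := 0) (hu := tailInd_nonneg m)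
  have hsum := (walk hd).poissonSummable_trans_pow (tailInd_nonneg m) (tailInd_le_one m) 0
  have heq : Q.lam * Q.occupation d T m - Q.rate d (m + 1) * Q.occupation d T (m + 1)
      = (1 / T) * poissonMix (fun j => ((walk hd).trans ^ j) (tailInd m) 0) (Q.unifRate * T) := by
    have h := hsum.integral_poissonMix Q.unifRate T
    simp only [← lam_mul_transProb_sub hd] at h
    rw [intervalIntegral.integral_sub (hint m _) (hint (m + 1) _),
      intervalIntegral.integral_const_mul, intervalIntegral.integral_const_mul] at h
    have h0 : ((walk hd).trans ^ 0) (tailInd m) 0 = 0 := by simp [tailInd]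
    rw [h0, sub_zero] at h
    rw [← h, occupation, occupation]
    ring
  have hs : 0 ≤ Q.unifRate * T := mul_nonneg Q.unifRate_pos.le hT
  have hTinv : 0 ≤ 1 / T := one_div_nonneg.2 hT
  rw [heq]
  exact ⟨mul_nonneg hTinv (poissonMix_nonneg hpos hs), mul_le_of_le_one_right hTinv
    (poissonMix_le hsum (fun j => (walk hd).trans_pow_le j (tailInd_le_one m) 0) hs)⟩

end Occupation

section Stationary

variable {K : ℕ} {Q : GroupServerQueue K} {d : ℕ → Fin K → ℕ} {w : ℕ → ℝ} {η : ℝ}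

/-- `w` is a stationary distribution of the number of customers under `d` (in the
detailed balance form available for birth-death processes). -/
structure IsStationary (Q : GroupServerQueue K) (d : ℕ → Fin K → ℕ) (w : ℕ → ℝ) : Prop where
  nonneg : ∀ n, 0 ≤ w n
  hasSum : HasSum w 1
  balance : ∀ n, Q.lam * w n = Q.rate d (n + 1) * w (n + 1)

theorem exists_tendsto_occupation (hd : Q.IsEfficient d) :
    ∃ F : Ultrafilter ℝ, ∃ w, ↑F ≤ (atTop : Filter ℝ) ∧ Tendsto (Q.occupation d) F (𝓝 w) := by
  have hK : IsCompact (Set.univ.pi fun _ : ℕ => Set.Icc (0 : ℝ) 1) :=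
    isCompact_univ_pi fun _ => isCompact_Icc
  have hmem : ∀ᶠ T in atTop, Q.occupation d T ∈ Set.univ.pi fun _ : ℕ => Set.Icc (0 : ℝ) 1 := by
    filter_upwards [eventually_gt_atTop 0] with T hT m _
    have h := sum_occupation_le_one hd hT {m}
    rw [Finset.sum_singleton] at h
    exact ⟨occupation_nonneg hd hT.le m, h⟩
  obtain ⟨w, -, hw⟩ := hK.exists_mapClusterPt_of_frequently hmem.frequently
  obtain ⟨F, hF, hFw⟩ := mapClusterPt_iff_ultrafilter.1 hw
  exact ⟨F, w, hF, hFw⟩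

section OccupationLimit

variable {F : Filter ℝ} [F.NeBot]

theorem nonneg_of_tendsto_occupation (hd : Q.IsEfficient d) (hF : F ≤ atTop)
    (hw : Tendsto (Q.occupation d) F (𝓝 w)) (m : ℕ) : 0 ≤ w m :=
  ge_of_tendsto (tendsto_pi_nhds.1 hw m) <|
    ((eventually_ge_atTop 0).filter_mono hF).mono fun _ hT => occupation_nonneg hd hT m

theorem sum_le_one_of_tendsto_occupation (hd : Q.IsEfficient d) (hF : F ≤ atTop)
    (hw : Tendsto (Q.occupation d) F (𝓝 w)) (S : Finset ℕ) : ∑ m ∈ S, w m ≤ 1 :=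
  le_of_tendsto (tendsto_finsetSum S fun m _ => tendsto_pi_nhds.1 hw m) <|
    ((eventually_gt_atTop 0).filter_mono hF).mono fun _ hT => sum_occupation_le_one hd hT S

theorem sum_mul_cost_sub_le_of_tendsto_occupation (hd : Q.IsEfficient d)
    (hη : Q.HasAverageCost d η) (hF : F ≤ atTop) (hw : Tendsto (Q.occupation d) F (𝓝 w))
    {S : Finset ℕ} {a : ℝ} (ha : ∀ m ∉ S, a ≤ Q.cost d m) :
    ∑ m ∈ S, w m * (Q.cost d m - a) ≤ η - a :=
  le_of_tendsto_of_tendsto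
    (tendsto_finsetSum S fun m _ => (tendsto_pi_nhds.1 hw m).mul_const _)
    (((hη 0).2.2.mono_left hF).sub_const a) <|
    ((eventually_gt_atTop 0).filter_mono hF).mono fun _ hT =>
      sum_occupation_mul_cost_sub_le hd hη ha hT

theorem balance_of_tendsto_occupation (hd : Q.IsEfficient d) (hF : F ≤ atTop)
    (hw : Tendsto (Q.occupation d) F (𝓝 w)) (m : ℕ) :
    Q.lam * w m = Q.rate d (m + 1) * w (m + 1) := by
  have hlim := ((tendsto_pi_nhds.1 hw m).const_mul Q.lam).sub
    ((tendsto_pi_nhds.1 hw (m + 1)).const_mul (Q.rate d (m + 1)))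
  have hmem : ∀ᶠ T in F, Q.lam * Q.occupation d T m
      - Q.rate d (m + 1) * Q.occupation d T (m + 1) ∈ Set.Icc 0 (1 / T) :=
    ((eventually_ge_atTop 0).filter_mono hF).mono fun T hT =>
      lam_mul_occupation_sub_mem_Icc hd hT m
  have hinv : Tendsto (fun T : ℝ => 1 / T) F (𝓝 0) := by
    simpa only [one_div] using tendsto_inv_atTop_zero.mono_left hF
  have hzero := tendsto_of_tendsto_of_tendsto_of_le_of_le' tendsto_const_nhds hinv
    (hmem.mono fun T hT => hT.1) (hmem.mono fun T hT => hT.2)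
  exact sub_eq_zero.1 (tendsto_nhds_unique hlim hzero)

/-- No mass escapes to infinity, because the holding cost is unbounded. -/
theorem hasSum_one_of_tendsto_occupation (hd : Q.IsEfficient d) (hη : Q.HasAverageCost d η)
    (hF : F ≤ atTop) (hw : Tendsto (Q.occupation d) F (𝓝 w)) : HasSum w 1 := by
  rw [hasSum_iff_tendsto_nat_of_nonneg (nonneg_of_tendsto_occupation hd hF hw)]
  have hgrow : Tendsto (fun N => Q.h N - Q.h 0) atTop atTop :=
    tendsto_atTop_add_const_right _ _ Q.h_tendsto
  have hlow : Tendsto (fun N => 1 - (η - Q.h 0) / (Q.h N - Q.h 0)) atTop (𝓝 1) := by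
    simpa only [sub_zero] using tendsto_const_nhds.sub (hgrow.const_div_atTop (η - Q.h 0))
  refine tendsto_of_tendsto_of_tendsto_of_le_of_le' hlow tendsto_const_nhds ?_
    (.of_forall fun N => sum_le_one_of_tendsto_occupation hd hF hw _)
  filter_upwards [hgrow.eventually_gt_atTop 0] with N hN
  have hcost : ∑ m ∈ Finset.range N, w m * (Q.cost d m - Q.h N) ≤ η - Q.h N :=
    sum_mul_cost_sub_le_of_tendsto_occupation hd hη hF hw fun m hm =>
      (Q.h_mono (by simpa using hm)).trans (Q.h_le_cost d m)
  have hlower : (∑ m ∈ Finset.range N, w m) * (Q.h 0 - Q.h N)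
      ≤ ∑ m ∈ Finset.range N, w m * (Q.cost d m - Q.h N) := by
    rw [Finset.sum_mul]
    exact Finset.sum_le_sum fun m _ => mul_le_mul_of_nonneg_left
      (sub_le_sub_right (Q.h_zero_le_cost d m) _) (nonneg_of_tendsto_occupation hd hF hw m)
  rw [sub_le_comm, le_div_iff₀ hN]
  linarith

end OccupationLimit

theorem exists_isStationary (hd : Q.IsEfficient d) (hη : Q.HasAverageCost d η) :
    ∃ w η', Q.IsStationary d w ∧ HasSum (fun n => w n * Q.cost d n) η' ∧ η' ≤ η := by
  obtain ⟨F, w, hF, hw⟩ := exists_tendsto_occupation hd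
  have hone := hasSum_one_of_tendsto_occupation hd hη hF hw
  have hnonneg := nonneg_of_tendsto_occupation hd hF hw
  have hterm (m : ℕ) : 0 ≤ w m * (Q.cost d m - Q.h 0) :=
    mul_nonneg (hnonneg m) (sub_nonneg.2 (Q.h_zero_le_cost d m))
  have hpartial (N : ℕ) : ∑ m ∈ Finset.range N, w m * (Q.cost d m - Q.h 0) ≤ η - Q.h 0 :=
    sum_mul_cost_sub_le_of_tendsto_occupation hd hη hF hw fun m _ => Q.h_zero_le_cost d m
  obtain ⟨x, hx⟩ := summable_of_sum_range_le hterm hpartial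
  refine ⟨w, x + Q.h 0, ⟨hnonneg, hone, balance_of_tendsto_occupation hd hF hw⟩, ?_, ?_⟩
  · rwa [← hasSum_mul_sub_const_iff hone, add_sub_cancel_right]
  · have hle := Real.tsum_le_of_sum_range_le hterm hpartial
    rw [hx.tsum_eq] at hle
    linarith

theorem HasAverageCost.unique {η' : ℝ} (h : Q.HasAverageCost d η) (h' : Q.HasAverageCost d η') :
    η = η' :=
  tendsto_nhds_unique (h 0).2.2 (h' 0).2.2

namespace IsStationary

theorem eq_zero_of_succ (hw : Q.IsStationary d w) {n : ℕ}
    (h : Q.rate d (n + 1) * w (n + 1) = 0) {m : ℕ} (hm : m ≤ n) : w m = 0 := by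
  induction hm using Nat.decreasingInduction with
  | self =>
    rw [← hw.balance n] at h
    exact (mul_eq_zero.1 h).resolve_left Q.lam_pos.ne'
  | of_succ m _ ih =>
    have hbal := hw.balance m
    rw [ih, mul_zero] at hbal
    exact (mul_eq_zero.1 hbal).resolve_left Q.lam_pos.ne'

theorem exists_ne_zero (hw : Q.IsStationary d w) : ∃ n, w n ≠ 0 := by
  by_contra! h
  have hone := hw.hasSum
  rw [funext h] at hone
  exact zero_ne_one (hasSum_zero.unique hone)

theorem pos (hw : Q.IsStationary d w) (hr : ∀ n, 0 < Q.rate d (n + 1)) (n : ℕ) : 0 < w n := by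
  induction n with
  | zero =>
    refine (hw.nonneg 0).lt_of_ne' fun h0 => ?_
    have hz (m : ℕ) : w m = 0 := by
      induction m with
      | zero => exact h0
      | succ m ih =>
        have hbal := hw.balance m
        rw [ih, mul_zero] at hbal
        exact (mul_eq_zero.1 hbal.symm).resolve_left (hr m).ne'
    obtain ⟨m, hm⟩ := hw.exists_ne_zero
    exact hm (hz m)
  | succ n ih =>
    refine (mul_pos_iff_of_pos_left (hr n)).1 ?_
    rw [← hw.balance n]
    exact mul_pos Q.lam_pos ih

theorem isReversible (hd : Q.IsEfficient d) (hw : Q.IsStationary d w)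
    (hr : ∀ n, 0 < Q.rate d (n + 1)) : (walk hd).IsReversible w where
  pos := hw.pos hr
  hasSum := hw.hasSum
  balance n := by
    have hbal := hw.balance n
    rw [← unifRate_mul_walk_p hd, ← unifRate_mul_walk_q hd, mul_assoc, mul_assoc] at hbal
    exact mul_left_cancel₀ Q.unifRate_pos.ne' hbal

end IsStationary

end Stationary

section Potential

variable {K : ℕ} {Q : GroupServerQueue K} {d : ℕ → Fin K → ℕ} {w g : ℕ → ℝ} {η : ℝ}

theorem tendsto_poissonMix_unifRate (Q : GroupServerQueue K) {x : ℕ → ℝ} {L : ℝ}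
    (hx : Tendsto x atTop (𝓝 L)) :
    Tendsto (fun t => poissonMix x (Q.unifRate * t)) atTop (𝓝 L) :=
  (tendsto_poissonMix (.of_tendsto hx) hx).comp (tendsto_id.const_mul_atTop Q.unifRate_pos)

theorem IsStationary.tendsto_jumpCost (hd : Q.IsEfficient d) (hw : Q.IsStationary d w)
    (hr : ∀ n, 0 < Q.rate d (n + 1)) (hη : HasSum (fun n => w n * Q.cost d n) η) (n : ℕ) :
    Tendsto (jumpCost hd n) atTop (𝓝 η) :=
  (hw.isReversible hd hr).tendsto_trans_pow hη n

theorem IsStationary.hasAverageCost (hd : Q.IsEfficient d) (hw : Q.IsStationary d w)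
    (hr : ∀ n, 0 < Q.rate d (n + 1)) (hη : HasSum (fun n => w n * Q.cost d n) η) :
    Q.HasAverageCost d η := fun n => by
  have hlim := hw.tendsto_jumpCost hd hr hη n
  have hs := PoissonSummable.of_tendsto hlim
  refine ⟨fun t ht => (hasSum_transProb_mul_cost hd hs ht).summable,
    fun T hT => intervalIntegrable_expCost hd hs hT,
    tendsto_average_of_tendsto (fun T hT => intervalIntegrable_expCost hd hs hT) ?_⟩
  refine (Q.tendsto_poissonMix_unifRate hlim).congr' ?_
  filter_upwards [eventually_ge_atTop 0] with t ht
  exact (expCost_eq hd hs ht).symm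

theorem IsStationary.isPotential (hd : Q.IsEfficient d) (hw : Q.IsStationary d w)
    (hr : ∀ n, 0 < Q.rate d (n + 1)) (hη : HasSum (fun n => w n * Q.cost d n) η) :
    Q.IsPotential d fun n => (walk hd).poissonSol w (Q.cost d) η n / Q.unifRate := by
  refine ⟨η, hw.hasAverageCost hd hr hη, fun n => ?_⟩
  have hrev := hw.isReversible hd hr
  have hL := Q.unifRate_pos
  have hs (n : ℕ) : PoissonSummable (jumpCost hd n) := .of_tendsto (hw.tendsto_jumpCost hd hr hη n)
  set g := (walk hd).poissonSol w (Q.cost d) η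
  set x : ℕ → ℝ := fun j =>
    -(((walk hd).trans ^ j) g n - ((walk hd).trans ^ j) g 0) / Q.unifRate with hx
  have hxlim : Tendsto x atTop (𝓝 0) := by
    simpa only [neg_zero, zero_div] using
      (hrev.tendsto_trans_pow_poissonSol_sub hη n).neg.div_const Q.unifRate
  have hstep (j : ℕ) : jumpCost hd n j - jumpCost hd 0 j = Q.unifRate * (x (j + 1) - x j) := by
    simp only [hx, jumpCost, g, hrev.trans_pow_succ_poissonSol]
    field_simp
    ring
  have hlim := (Q.tendsto_poissonMix_unifRate hxlim).sub_const (x 0)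
  have hend : 0 - x 0 = g n / Q.unifRate - g 0 / Q.unifRate := by
    simp only [hx, pow_zero, Module.End.one_apply]
    ring
  rw [hend] at hlim
  refine hlim.congr' ?_
  filter_upwards [eventually_ge_atTop 0] with T hT
  rw [integral_expCost_sub_sub hd (hs n) (hs 0) η hT]
  simp only [hstep]
  exact ((PoissonSummable.of_tendsto hxlim).integral_poissonMix Q.unifRate T).symm

theorem expCost_sub_cost (hd : Q.IsEfficient d) (hs : ∀ n, PoissonSummable (jumpCost hd n))
    (η : ℝ) {T : ℝ} (hT : 0 ≤ T) (n : ℕ) :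
    Q.expCost d T n - Q.cost d n
      = Q.lam * ((∫ t in (0 : ℝ)..T, (Q.expCost d t (n + 1) - η))
          - ∫ t in (0 : ℝ)..T, (Q.expCost d t n - η))
        - Q.rate d n * ((∫ t in (0 : ℝ)..T, (Q.expCost d t n - η))
          - ∫ t in (0 : ℝ)..T, (Q.expCost d t (n - 1) - η)) := by
  have hsub (n m : ℕ) (b : ℝ) := ((hs n).sub (hs m)).const_mul b
  have hint (n m : ℕ) := Q.intervalIntegrable_poissonMix_unifRate ((hs n).sub (hs m)) T
  have hstep (j : ℕ) : Q.unifRate * (jumpCost hd n (j + 1) - jumpCost hd n j)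
      = Q.lam * (jumpCost hd (n + 1) j - jumpCost hd n j)
        - Q.rate d n * (jumpCost hd n j - jumpCost hd (n - 1) j) := by
    simp only [jumpCost]
    rw [BirthDeathWalk.trans_pow_succ, ← unifRate_mul_walk_p hd, ← unifRate_mul_walk_q hd n]
    ring
  have hdynkin := (hs n).integral_poissonMix Q.unifRate T
  simp only [hstep, poissonMix_sub (hsub _ _ _) (hsub _ _ _), poissonMix_const_mul] at hdynkin
  rw [intervalIntegral.integral_sub ((hint _ _).const_mul _) ((hint _ _).const_mul _),
    intervalIntegral.integral_const_mul, intervalIntegral.integral_const_mul,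
    ← integral_expCost_sub_sub hd (hs _) (hs _) η hT,
    ← integral_expCost_sub_sub hd (hs _) (hs _) η hT, ← expCost_eq hd (hs n) hT] at hdynkin
  exact hdynkin.symm

/-- Dynkin's formula makes `expCost` converge, necessarily to the limit `η` of its averages. -/
theorem IsPotential.poisson_eq (hd : Q.IsEfficient d) (hg : Q.IsPotential d g)
    (hη : Q.HasAverageCost d η) (n : ℕ) :
    Q.lam * (g (n + 1) - g n) - Q.rate d n * (g n - g (n - 1)) = η - Q.cost d n := by
  obtain ⟨η', hη', hlim⟩ := hg
  obtain rfl := hη.unique hη'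
  have hs (n : ℕ) : PoissonSummable (jumpCost hd n) := poissonSummable_jumpCost hd (hη n).1
  have hflow := (((hlim (n + 1)).sub (hlim n)).const_mul Q.lam).sub
    (((hlim n).sub (hlim (n - 1))).const_mul (Q.rate d n))
  simp only [sub_sub_sub_cancel_right] at hflow
  have hexp : Tendsto (Q.expCost d · n) atTop (𝓝 (Q.lam * (g (n + 1) - g n)
      - Q.rate d n * (g n - g (n - 1)) + Q.cost d n)) := by
    refine (hflow.add_const (Q.cost d n)).congr' ?_
    filter_upwards [eventually_ge_atTop 0] with T hT
    linarith [expCost_sub_cost hd hs η hT n]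
  exact eq_sub_of_add_eq
    (tendsto_nhds_unique (tendsto_average_of_tendsto (hη n).2.1 hexp) (hη n).2.2)

end Potential

section Action

variable {K : ℕ} {Q : GroupServerQueue K} {n : ℕ} {x κ : ℝ} {a b : Fin K → ℕ}

/-- The net benefit rate of a working server of group `k` if serving a customer is worth `x`. -/
noncomputable def reward (Q : GroupServerQueue K) (k : Fin K) (x : ℝ) : ℝ :=
  Q.mu k * x - Q.c k

/-- The net benefit rate of the action `a` if serving a customer is worth `x`. -/
noncomputable def net (Q : GroupServerQueue K) (a : Fin K → ℕ) (x : ℝ) : ℝ :=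
  ∑ k, (a k : ℝ) * Q.reward k x

/-- The actions of efficient policies in state `n`. -/
def IsFeasible (Q : GroupServerQueue K) (n : ℕ) (a : Fin K → ℕ) : Prop :=
  (∀ k, a k ≤ Q.M k) ∧ ∑ k, a k ≤ n

/-- The actions of maximal net benefit rate in state `n` if serving a customer is worth `x`. -/
def IsBestAction (Q : GroupServerQueue K) (n : ℕ) (x : ℝ) (b : Fin K → ℕ) : Prop :=
  Q.IsFeasible n b ∧ ∀ a, Q.IsFeasible n a → Q.net a x ≤ Q.net b x

/-- The action `b` obeys the `c/μ`-rule in state `n` if serving a customer is worth `x`. -/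
def ObeysRule (Q : GroupServerQueue K) (n : ℕ) (x : ℝ) (b : Fin K → ℕ) : Prop :=
  ∀ k, (Q.c k / Q.mu k < x → b k = min (Q.M k) (n - ∑ l ∈ Finset.Iio k, b l)) ∧
    (x < Q.c k / Q.mu k → b k = 0)

theorem reward_pos_iff (Q : GroupServerQueue K) (k : Fin K) (x : ℝ) :
    0 < Q.reward k x ↔ Q.c k / Q.mu k < x :=
  sub_pos.trans (div_lt_iff₀' (Q.mu_pos k)).symm

theorem reward_neg_iff (Q : GroupServerQueue K) (k : Fin K) (x : ℝ) :
    Q.reward k x < 0 ↔ x < Q.c k / Q.mu k :=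
  sub_neg.trans (lt_div_iff₀' (Q.mu_pos k)).symm

theorem reward_div (Q : GroupServerQueue K) (k : Fin K) : Q.reward k (Q.c k / Q.mu k) = 0 := by
  rw [reward, mul_div_cancel₀ _ (Q.mu_pos k).ne', sub_self]

theorem net_zero (Q : GroupServerQueue K) (x : ℝ) : Q.net 0 x = 0 := by
  simp only [net, Pi.zero_apply, Nat.cast_zero, zero_mul, Finset.sum_const_zero]

theorem net_add (Q : GroupServerQueue K) (a b : Fin K → ℕ) (x : ℝ) :
    Q.net (a + b) x = Q.net a x + Q.net b x := by
  simp only [net, Pi.add_apply, Nat.cast_add, add_mul, Finset.sum_add_distrib]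

theorem net_single (Q : GroupServerQueue K) (k : Fin K) (x : ℝ) :
    Q.net (Pi.single k 1) x = Q.reward k x := by
  simp only [net, Pi.single_apply, Nat.cast_ite, Nat.cast_one, Nat.cast_zero, ite_mul, one_mul,
    zero_mul, Finset.sum_ite_eq', Finset.mem_univ, if_true]

theorem ScaleEconomies.reward_lt (hQ : Q.ScaleEconomies) {k l : Fin K} (hkl : k < l)
    (hk : 0 < Q.reward k x) : Q.reward l x < Q.reward k x := by
  rcases le_or_gt (Q.reward l x) 0 with hl | hl
  · exact hl.trans_lt hk
  have hratio : Q.c k / Q.mu k ≤ Q.c l / Q.mu l := hQ.1 hkl.le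
  have hmu : Q.mu l ≤ Q.mu k := hQ.2 hkl.le
  rcases hmu.lt_or_eq with hlt | heq
  · have hreward (i : Fin K) : Q.reward i x = Q.mu i * (x - Q.c i / Q.mu i) := by
      rw [mul_sub, mul_div_cancel₀ _ (Q.mu_pos i).ne', reward]
    rw [hreward, hreward]
    calc Q.mu l * (x - Q.c l / Q.mu l) < Q.mu k * (x - Q.c l / Q.mu l) :=
          mul_lt_mul_of_pos_right hlt (sub_pos.2 ((Q.reward_pos_iff l x).1 hl))
      _ ≤ Q.mu k * (x - Q.c k / Q.mu k) :=
          mul_le_mul_of_nonneg_left (sub_le_sub_left hratio x) (Q.mu_pos k).le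
  · rw [heq, div_le_div_iff_of_pos_right (Q.mu_pos k)] at hratio
    have hc : Q.c k ≠ Q.c l := (Q.heterogeneous k l hkl.ne).resolve_left (not_not.2 heq.symm)
    rw [reward, reward, heq]
    exact sub_lt_sub_left (hratio.lt_of_ne hc) _

theorem sum_Iio_add_add_sum_Ioi (b : Fin K → ℕ) (k : Fin K) :
    ∑ l ∈ Finset.Iio k, b l + b k + ∑ l ∈ Finset.Ioi k, b l = ∑ l, b l := by
  have hcompl : (Finset.Iic k)ᶜ = Finset.Ioi k := by ext; simp
  rw [Finset.sum_Iio_add_eq_sum_Iic, ← hcompl, Finset.sum_add_sum_compl]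

namespace ObeysRule

theorem net_eq_zero (hb : Q.ObeysRule n x b) (hbM : ∀ k, b k ≤ Q.M k)
    (hκ : ∀ k, 0 < Q.M k → κ ≤ Q.c k / Q.mu k) (hx : x ≤ κ) : Q.net b x = 0 := by
  refine Finset.sum_eq_zero fun k _ => ?_
  rcases Nat.eq_zero_or_pos (b k) with hbk | hbk
  · rw [hbk, Nat.cast_zero, zero_mul]
  · have hge : Q.c k / Q.mu k ≤ x := le_of_not_gt fun hlt => hbk.ne' ((hb k).2 hlt)
    have hle : x ≤ Q.c k / Q.mu k := hx.trans (hκ k (hbk.trans_le (hbM k)))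
    rw [hle.antisymm hge, reward_div, mul_zero]

theorem eq_zero (hb : Q.ObeysRule n x b) (hbM : ∀ k, b k ≤ Q.M k)
    (hκ : ∀ k, 0 < Q.M k → κ ≤ Q.c k / Q.mu k) (hx : x < κ) : b = 0 := by
  ext k
  rcases Nat.eq_zero_or_pos (Q.M k) with hk | hk
  · exact Nat.le_zero.1 (hk ▸ hbM k)
  · exact (hb k).2 (hx.trans_le (hκ k hk))

theorem ne_zero (hb : Q.ObeysRule n x b) (hn : 0 < n) {k : Fin K} (hk : 0 < Q.M k)
    (hx : Q.c k / Q.mu k < x) : b ≠ 0 := by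
  rintro rfl
  have hbk := (hb k).1 hx
  simp only [Pi.zero_apply, Finset.sum_const_zero, Nat.sub_zero] at hbk
  omega

theorem eq_M (hb : Q.ObeysRule n x b) (hbM : ∀ k, b k ≤ Q.M k) (hn : ∑ k, Q.M k ≤ n)
    (hx : ∀ k, Q.c k / Q.mu k < x) : b = Q.M := by
  ext k
  have hbk := (hb k).1 (hx k)
  have hIio : ∑ l ∈ Finset.Iio k, b l ≤ ∑ l ∈ Finset.Iio k, Q.M l :=
    Finset.sum_le_sum fun l _ => hbM l
  have hM := sum_Iio_add_add_sum_Ioi Q.M k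
  omega

theorem net_nonneg (hb : Q.ObeysRule n x b) : 0 ≤ Q.net b x := by
  refine Finset.sum_nonneg fun k _ => ?_
  rcases lt_or_ge (Q.reward k x) 0 with hk | hk
  · rw [(hb k).2 ((Q.reward_neg_iff k x).1 hk), Nat.cast_zero, zero_mul]
  · exact mul_nonneg (Nat.cast_nonneg _) hk

theorem sum_eq_and_eq_zero_of_ne_M (hb : Q.ObeysRule n x b) (hbn : ∑ k, b k ≤ n) {k : Fin K}
    (hk : 0 < Q.reward k x) (hne : b k ≠ Q.M k) : ∑ l, b l = n ∧ ∀ l, k < l → b l = 0 := by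
  have hbk := (hb k).1 ((Q.reward_pos_iff k x).1 hk)
  have hsum := sum_Iio_add_add_sum_Ioi b k
  have hIoi : ∑ l ∈ Finset.Ioi k, b l = 0 := by omega
  exact ⟨by omega, fun l hl => Finset.sum_eq_zero_iff.1 hIoi l (Finset.mem_Ioi.2 hl)⟩

end ObeysRule

theorem net_le_net_of_threshold {θ : ℝ} (h : ∀ k, 0 ≤ ((b k : ℝ) - a k) * (Q.reward k x - θ))
    (hθ : θ * ∑ k, (a k : ℝ) ≤ θ * ∑ k, (b k : ℝ)) : Q.net a x ≤ Q.net b x := by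
  have hexpand : ∑ k, ((b k : ℝ) - a k) * (Q.reward k x - θ)
      = Q.net b x - Q.net a x - (θ * ∑ k, (b k : ℝ) - θ * ∑ k, (a k : ℝ)) := by
    simp only [net, Finset.mul_sum, ← Finset.sum_sub_distrib]
    exact Finset.sum_congr rfl fun k _ => by ring
  have hsum := Finset.sum_nonneg fun k (_ : k ∈ Finset.univ) => h k
  linarith

/-- The threshold is the reward of the first rewarding group that the rule leaves incomplete. -/
theorem ObeysRule.isBestAction (hQ : Q.ScaleEconomies) (hb : Q.ObeysRule n x b)
    (hfeas : Q.IsFeasible n b) : Q.IsBestAction n x b := by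
  refine ⟨hfeas, fun a ha => ?_⟩
  have hzero (l : Fin K) (hl : Q.reward l x < 0) : b l = 0 :=
    (hb l).2 ((Q.reward_neg_iff l x).1 hl)
  have hfull (l : Fin K) (hl : b l = Q.M l) : (0 : ℝ) ≤ b l - a l := by
    rw [hl, sub_nonneg]
    exact_mod_cast ha.1 l
  have hempty (l : Fin K) (hl : b l = 0) : (b l : ℝ) - a l ≤ 0 := by
    rw [hl, Nat.cast_zero, zero_sub]
    exact neg_nonpos.2 (Nat.cast_nonneg _)
  by_cases hsat : ∀ l, 0 < Q.reward l x → b l = Q.M l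
  · refine net_le_net_of_threshold (θ := 0) (fun l => ?_) (by simp only [zero_mul, le_refl])
    rw [sub_zero]
    rcases lt_trichotomy (Q.reward l x) 0 with hl | hl | hl
    · exact mul_nonneg_of_nonpos_of_nonpos (hempty l (hzero l hl)) hl.le
    · rw [hl, mul_zero]
    · exact mul_nonneg (hfull l (hsat l hl)) hl.le
  · push Not at hsat
    obtain ⟨k, ⟨hk, hkM⟩, hmin⟩ := WellFounded.has_min wellFounded_lt
      {k | 0 < Q.reward k x ∧ b k ≠ Q.M k} hsat
    obtain ⟨hsum, hlate⟩ := hb.sum_eq_and_eq_zero_of_ne_M hfeas.2 hk hkM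
    refine net_le_net_of_threshold (θ := Q.reward k x) (fun l => ?_) ?_
    · rcases lt_trichotomy l k with hl | rfl | hl
      · have hpos : 0 < Q.reward l x := by
          rw [reward_pos_iff] at hk ⊢
          exact (hQ.1 hl.le).trans_lt hk
        have hlM : b l = Q.M l := by_contra fun hne => hmin l ⟨hpos, hne⟩ hl
        exact mul_nonneg (hfull l hlM) (sub_nonneg.2 (hQ.reward_lt hl hpos).le)
      · rw [sub_self, mul_zero]
      · exact mul_nonneg_of_nonpos_of_nonpos (hempty l (hlate l hl))
          (sub_nonpos.2 (hQ.reward_lt hl hk).le)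
    · refine mul_le_mul_of_nonneg_left ?_ hk.le
      exact_mod_cast ha.2.trans_eq hsum.symm

theorem sum_add_single (b : Fin K → ℕ) (k : Fin K) :
    ∑ l, (b + Pi.single k 1 : Fin K → ℕ) l = ∑ l, b l + 1 := by
  simp only [Pi.add_apply, Finset.sum_add_distrib, Finset.sum_pi_single', Finset.mem_univ, if_true]

theorem exists_add_single_eq {k : Fin K} (hk : 0 < b k) :
    ∃ a : Fin K → ℕ, a + Pi.single k 1 = b := by
  refine ⟨b - Pi.single k 1, tsub_add_cancel_of_le fun l => ?_⟩
  rw [Pi.single_apply]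
  split_ifs with hl
  · exact hl ▸ hk
  · exact Nat.zero_le _

theorem IsFeasible.add_single (ha : Q.IsFeasible n a) {k : Fin K} (hk : a k < Q.M k)
    (hn : ∑ l, a l < n) : Q.IsFeasible n (a + Pi.single k 1) := by
  refine ⟨fun l => ?_, (sum_add_single a k).trans_le hn⟩
  rw [Pi.add_apply, Pi.single_apply]
  split_ifs with hl
  · exact hl ▸ hk
  · exact ha.1 l

theorem IsFeasible.of_add (h : Q.IsFeasible n (a + b)) : Q.IsFeasible n a :=
  ⟨fun k => le_self_add.trans (h.1 k), (Finset.sum_le_sum fun _ _ => le_self_add).trans h.2⟩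

namespace IsBestAction

theorem reward_nonpos (hb : Q.IsBestAction n x b) {k : Fin K} (hk : b k < Q.M k)
    (hn : ∑ l, b l < n) : Q.reward k x ≤ 0 := by
  have hle := hb.2 _ (hb.1.add_single hk hn)
  rw [net_add, net_single] at hle
  linarith

theorem reward_nonneg (hb : Q.IsBestAction n x b) {k : Fin K} (hk : 0 < b k) :
    0 ≤ Q.reward k x := by
  obtain ⟨a, rfl⟩ := exists_add_single_eq hk
  have hle := hb.2 a hb.1.of_add
  rw [net_add, net_single] at hle
  linarith

theorem reward_le_reward (hb : Q.IsBestAction n x b) {k l : Fin K} (hk : b k < Q.M k)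
    (hl : 0 < b l) : Q.reward k x ≤ Q.reward l x := by
  obtain ⟨a, rfl⟩ := exists_add_single_eq hl
  have hn := hb.1.2
  rw [sum_add_single] at hn
  have hle := hb.2 _ (hb.1.of_add.add_single (le_self_add.trans_lt hk) hn)
  rw [net_add, net_single, net_add, net_single] at hle
  linarith

theorem obeysRule (hQ : Q.ScaleEconomies) (hb : Q.IsBestAction n x b) : Q.ObeysRule n x b := by
  refine fun k => ⟨fun hx => ?_, fun hx => Nat.eq_zero_of_not_pos fun hk =>
    ((Q.reward_neg_iff k x).2 hx).not_ge (hb.reward_nonneg hk)⟩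
  have hk := (Q.reward_pos_iff k x).2 hx
  have hbM := hb.1.1 k
  have hbn := hb.1.2
  have hsum := sum_Iio_add_add_sum_Ioi b k
  by_contra hne
  have hlt : b k < Q.M k := by omega
  have hfull : ¬ ∑ l, b l < n := fun hn => hk.not_ge (hb.reward_nonpos hlt hn)
  obtain ⟨l, hl, hbl⟩ := Finset.exists_ne_zero_of_sum_ne_zero
    (show ∑ l ∈ Finset.Ioi k, b l ≠ 0 by omega)
  exact (hQ.reward_lt (Finset.mem_Ioi.1 hl) hk).not_ge
    (hb.reward_le_reward hlt (Nat.pos_of_ne_zero hbl))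

end IsBestAction

theorem net_nonpos (ha : ∀ k, a k ≤ Q.M k) (hκ : ∀ k, 0 < Q.M k → κ ≤ Q.c k / Q.mu k) :
    Q.net a κ ≤ 0 := by
  refine Finset.sum_nonpos fun k _ => ?_
  rcases Nat.eq_zero_or_pos (a k) with hak | hak
  · rw [hak, Nat.cast_zero, zero_mul]
  · exact mul_nonpos_of_nonneg_of_nonpos (Nat.cast_nonneg _) <| not_lt.1 fun hpos =>
      (hκ k (hak.trans_le (ha k))).not_gt ((Q.reward_pos_iff k κ).1 hpos)

end Action

section Comparison

variable {K : ℕ} {Q : GroupServerQueue K} {d d' : ℕ → Fin K → ℕ} {w g G : ℕ → ℝ} {η ζ : ℝ}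

theorem cost_eq (Q : GroupServerQueue K) (d : ℕ → Fin K → ℕ) (n : ℕ) (x : ℝ) :
    Q.cost d n = Q.h n + Q.rate d n * x - Q.net (d n) x := by
  simp only [cost, rate, net, reward, mul_sub, Finset.sum_sub_distrib, Finset.sum_mul, ← mul_assoc]
  ring

theorem rate_pos_of_ne_zero {n : ℕ} (h : d n ≠ 0) : 0 < Q.rate d n := by
  obtain ⟨k, hk⟩ := Function.ne_iff.1 h
  exact Finset.sum_pos' (fun k _ => mul_nonneg (Nat.cast_nonneg _) (Q.mu_pos k).le)
    ⟨k, Finset.mem_univ k, mul_pos (Nat.cast_pos.2 (Nat.pos_of_ne_zero hk)) (Q.mu_pos k)⟩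

/-- The Poisson equation of the policy `d` with average cost `η`, in terms of the increments `G`
of the potential. -/
def SolvesPoisson (Q : GroupServerQueue K) (d : ℕ → Fin K → ℕ) (η : ℝ) (G : ℕ → ℝ) : Prop :=
  ∀ n, Q.lam * G (n + 1) = η - Q.h n + Q.net (d n) (G n)

theorem IsPotential.solvesPoisson (hd : Q.IsEfficient d) (hg : Q.IsPotential d g)
    (hη : Q.HasAverageCost d η) : Q.SolvesPoisson d η (prf g) := by
  intro n
  have hpoisson := hg.poisson_eq hd hη n
  rw [Q.cost_eq d n (prf g n)] at hpoisson
  simp only [prf, Nat.add_sub_cancel] at hpoisson ⊢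
  linarith

theorem IsPotential.prf_eq {g' : ℕ → ℝ} (hg : Q.IsPotential d g) (hg' : Q.IsPotential d g') :
    prf g = prf g' := by
  obtain ⟨η, hη, hlim⟩ := hg
  obtain ⟨η', hη', hlim'⟩ := hg'
  obtain rfl := hη.unique hη'
  have hsub (n : ℕ) : g n - g 0 = g' n - g' 0 := tendsto_nhds_unique (hlim n) (hlim' n)
  ext n
  rw [prf, prf, ← sub_sub_sub_cancel_right _ _ (g 0), hsub, hsub, sub_sub_sub_cancel_right]

namespace IsStationary

/-- Summation by parts: the balance equations telescope. -/
theorem sum_cost_sub_add (hd : Q.IsEfficient d) (hw : Q.IsStationary d w) (η : ℝ) (G : ℕ → ℝ)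
    (N : ℕ) :
    ∑ i ∈ Finset.range (N + 1), w i * (Q.cost d i - η) + Q.lam * w N * G (N + 1)
      = ∑ i ∈ Finset.range (N + 1),
          w i * (Q.lam * G (i + 1) + Q.h i - Q.net (d i) (G i) - η) := by
  induction N with
  | zero =>
    simp only [zero_add, Finset.range_one, Finset.sum_singleton, Q.cost_eq d 0 (G 0), hd.rate_zero]
    ring
  | succ N ih =>
    rw [Finset.sum_range_succ, Finset.sum_range_succ _ (N + 1), ← ih,
      Q.cost_eq d (N + 1) (G (N + 1))]
    linear_combination -G (N + 1) * hw.balance N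

/-- The performance difference formula, truncated at `N`. -/
theorem sum_cost_sub_add_of_solvesPoisson (hd' : Q.IsEfficient d') (hw : Q.IsStationary d' w)
    (hG : Q.SolvesPoisson d η G) (N : ℕ) :
    ∑ i ∈ Finset.range (N + 1), w i * (Q.cost d' i - η) + Q.lam * w N * G (N + 1)
      = ∑ i ∈ Finset.range (N + 1), w i * (Q.net (d i) (G i) - Q.net (d' i) (G i)) := by
  rw [hw.sum_cost_sub_add hd']
  refine Finset.sum_congr rfl fun i _ => ?_
  rw [hG i]
  ring

theorem lam_mul_eq (hd : Q.IsEfficient d) (hw : Q.IsStationary d w) (hG : Q.SolvesPoisson d η G)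
    (N : ℕ) :
    Q.lam * w N * G (N + 1) = -∑ i ∈ Finset.range (N + 1), w i * (Q.cost d i - η) := by
  have hsum := hw.sum_cost_sub_add_of_solvesPoisson hd hG N
  simp only [sub_self, mul_zero, Finset.sum_const_zero] at hsum
  linarith

theorem hasSum_tail (hd : Q.IsEfficient d) (hw : Q.IsStationary d w) (hG : Q.SolvesPoisson d η G)
    (hη : HasSum (fun n => w n * Q.cost d n) η) (n : ℕ) :
    HasSum (fun j => w (j + (n + 1)) * (Q.cost d (j + (n + 1)) - η))
      (Q.lam * w n * G (n + 1)) := by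
  have htail := (hasSum_nat_add_iff' (n + 1)).2 ((hasSum_mul_sub_const_iff hw.hasSum (b := η)).2 hη)
  rwa [sub_self, zero_sub, ← hw.lam_mul_eq hd hG] at htail

theorem tendsto_sum_cost_sub (hw : Q.IsStationary d w) (hζ : HasSum (fun n => w n * Q.cost d n) ζ)
    (η : ℝ) : Tendsto (fun N => ∑ i ∈ Finset.range (N + 1), w i * (Q.cost d i - η)) atTop
      (𝓝 (ζ - η)) :=
  ((hasSum_mul_sub_const_iff hw.hasSum).2 hζ).tendsto_sum_nat.comp (tendsto_add_atTop_nat 1)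

theorem exists_rate_ne_zero (hw : Q.IsStationary d w) (N : ℕ) :
    ∃ n, N ≤ n ∧ Q.rate d (n + 1) ≠ 0 := by
  by_contra! h
  obtain ⟨m, hm⟩ := hw.exists_ne_zero
  exact hm (hw.eq_zero_of_succ (n := max N m) (by rw [h _ (le_max_left _ _), zero_mul])
    (le_max_right _ _))

theorem exists_cheapest (hd : Q.IsEfficient d) (hw : Q.IsStationary d w) :
    ∃ k, 0 < Q.M k ∧ ∀ l, 0 < Q.M l → Q.c k / Q.mu k ≤ Q.c l / Q.mu l := by
  obtain ⟨n, -, hn⟩ := hw.exists_rate_ne_zero 0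
  obtain ⟨k, -, hk⟩ := Finset.exists_ne_zero_of_sum_ne_zero hn
  have hdk : 0 < d (n + 1) k :=
    Nat.pos_of_ne_zero fun h0 => hk (by rw [h0, Nat.cast_zero, zero_mul])
  obtain ⟨l, hl, hmin⟩ := Finset.exists_min_image ({k | 0 < Q.M k} : Finset (Fin K))
    (fun k => Q.c k / Q.mu k)
    ⟨k, Finset.mem_filter.2 ⟨Finset.mem_univ k, hdk.trans_le ((hd (n + 1)).1 k)⟩⟩
  simp only [Finset.mem_filter, Finset.mem_univ, true_and] at hl hmin
  exact ⟨l, hl, hmin⟩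

end IsStationary

end Comparison

section Sufficiency

variable {K : ℕ} {Q : GroupServerQueue K} {d d' : ℕ → Fin K → ℕ} {w w' g G : ℕ → ℝ} {η ζ κ : ℝ}

/-- If `G (n + 1) ≤ κ`, the rule earns nothing from state `n + 1` on, so `G` stays below `κ`, and
strictly so once `h` has grown: the rule would keep all servers off in all large states. -/
theorem SolvesPoisson.lt_of_obeysRule (hG : Q.SolvesPoisson d η G) (hd : Q.IsEfficient d)
    (hw : Q.IsStationary d w) (hrule : ∀ n, Q.ObeysRule n (G n) (d n))
    (hκ : ∀ k, 0 < Q.M k → κ ≤ Q.c k / Q.mu k) (n : ℕ) : κ < G (n + 1) := by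
  by_contra! hn
  have hh : η - Q.h n ≤ Q.lam * κ := by
    have hpoisson := hG n
    have hnet := (hrule n).net_nonneg
    have hmul := mul_le_mul_of_nonneg_left hn Q.lam_pos.le
    linarith
  have hstep (m : ℕ) (hm : G (m + 1) ≤ κ) :
      Q.lam * G (m + 1 + 1) ≤ Q.lam * κ - (Q.h (m + 1) - Q.h n) := by
    rw [hG (m + 1), (hrule (m + 1)).net_eq_zero (hd (m + 1)).1 hκ hm]
    linarith
  have hle (m : ℕ) (hm : n ≤ m) : G (m + 1) ≤ κ := by
    induction hm with
    | refl => exact hn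
    | @step m hm ih =>
      have hmono := Q.h_mono (Nat.le_succ_of_le hm)
      exact le_of_mul_le_mul_left ((hstep m ih).trans (by linarith)) Q.lam_pos
  obtain ⟨N, hN⟩ := (Q.h_tendsto.eventually_gt_atTop (Q.h n)).exists_forall_of_atTop
  obtain ⟨m, hm, hrate⟩ := hw.exists_rate_ne_zero (max N n + 1)
  obtain ⟨m, rfl⟩ : ∃ m', m = m' + 1 := ⟨m - 1, by omega⟩
  have hlt : G (m + 1 + 1) < κ := by
    have hgrow := hN (m + 1) (by omega)
    exact lt_of_mul_lt_mul_left ((hstep m (hle m (by omega))).trans_lt (by linarith)) Q.lam_pos.le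
  have hoff := (hrule (m + 1 + 1)).eq_zero (hd (m + 1 + 1)).1 hκ hlt
  exact hrate (by simp only [rate, hoff, Pi.zero_apply, Nat.cast_zero, zero_mul,
    Finset.sum_const_zero])

theorem SolvesPoisson.tendsto_atTop (hG : Q.SolvesPoisson d η G) (hd : Q.IsEfficient d)
    (hw : Q.IsStationary d w) (hr : ∀ n, 0 < Q.rate d (n + 1))
    (hη : HasSum (fun n => w n * Q.cost d n) η) : Tendsto G atTop atTop := by
  set S := ∑ k, (Q.M k : ℝ) * Q.mu k
  have hS : 0 < S := (hr 0).trans_le (hd.rate_le 1)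
  rw [← tendsto_add_atTop_iff_nat 1]
  have hh := Q.h_tendsto.comp (tendsto_add_atTop_nat 1)
  have hlower : Tendsto (fun n => (Q.h (n + 1) - η) / S) atTop atTop :=
    (tendsto_atTop_add_const_right _ _ hh).atTop_div_const hS
  refine tendsto_atTop_mono' _ ?_ hlower
  filter_upwards [hh.eventually_ge_atTop η] with n (hn : η ≤ Q.h (n + 1))
  have hcost (j : ℕ) : 0 ≤ Q.cost d (j + (n + 1)) - η :=
    sub_nonneg.2 (hn.trans ((Q.h_mono (Nat.le_add_left _ _)).trans (Q.h_le_cost d _)))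
  have hfirst := le_hasSum (hw.hasSum_tail hd hG hη n) 0
    fun j _ => mul_nonneg (hw.nonneg _) (hcost j)
  rw [hw.balance n, zero_add, mul_right_comm, mul_comm] at hfirst
  have hrateG : Q.cost d (n + 1) - η ≤ Q.rate d (n + 1) * G (n + 1) :=
    le_of_mul_le_mul_right hfirst (hw.pos hr (n + 1))
  have hG0 : 0 ≤ G (n + 1) := by
    have hcost0 := hcost 0
    rw [zero_add] at hcost0
    exact nonneg_of_mul_nonneg_right (hcost0.trans hrateG) (hr n)
  rw [div_le_iff₀ hS, mul_comm]
  calc Q.h (n + 1) - η ≤ Q.cost d (n + 1) - η := sub_le_sub_right (Q.h_le_cost d _) η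
    _ ≤ Q.rate d (n + 1) * G (n + 1) := hrateG
    _ ≤ S * G (n + 1) := mul_le_mul_of_nonneg_right (hd.rate_le (n + 1)) hG0

theorem SolvesPoisson.eventually_eq_M (hG : Q.SolvesPoisson d η G) (hd : Q.IsEfficient d)
    (hw : Q.IsStationary d w) (hr : ∀ n, 0 < Q.rate d (n + 1))
    (hη : HasSum (fun n => w n * Q.cost d n) η) (hrule : ∀ n, Q.ObeysRule n (G n) (d n)) :
    ∀ᶠ n in atTop, d n = Q.M := by
  filter_upwards [eventually_all.2 fun k =>
    (hG.tendsto_atTop hd hw hr hη).eventually_gt_atTop (Q.c k / Q.mu k),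
    eventually_ge_atTop (∑ k, Q.M k)] with n hratio hn
  exact (hrule n).eq_M (hd n).1 hn hratio

/-- The stationary distribution of a policy that eventually uses all servers decays fastest. -/
theorem IsStationary.mul_le_mul_of_full (hd' : Q.IsEfficient d') (hw : Q.IsStationary d w)
    (hw' : Q.IsStationary d' w') {N : ℕ} (hfull : ∀ n, N ≤ n → d n = Q.M)
    (hr : 0 < Q.rate d N) {n : ℕ} (hn : N ≤ n) (j : ℕ) : w' n * w (j + n) ≤ w n * w' (j + n) := by
  have hrate (m : ℕ) (hm : N ≤ m) : Q.rate d m = ∑ k, (Q.M k : ℝ) * Q.mu k := by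
    rw [rate, hfull m hm]
  set S := ∑ k, (Q.M k : ℝ) * Q.mu k
  induction j with
  | zero => rw [zero_add, mul_comm]
  | succ j ih =>
    rw [Nat.add_right_comm]
    have hbal := hw.balance (j + n)
    rw [hrate (j + n + 1) (by omega)] at hbal
    have hbal' : Q.lam * w' (j + n) ≤ S * w' (j + n + 1) :=
      (hw'.balance (j + n)).trans_le
        (mul_le_mul_of_nonneg_right (hd'.rate_le _) (hw'.nonneg _))
    refine le_of_mul_le_mul_left ?_ ((hr.trans_eq (hrate N le_rfl) : 0 < S))
    calc S * (w' n * w (j + n + 1)) = Q.lam * (w' n * w (j + n)) := by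
          linear_combination -(w' n) * hbal
      _ ≤ Q.lam * (w n * w' (j + n)) := mul_le_mul_of_nonneg_left ih Q.lam_pos.le
      _ = w n * (Q.lam * w' (j + n)) := mul_left_comm _ _ _
      _ ≤ w n * (S * w' (j + n + 1)) := mul_le_mul_of_nonneg_left hbal' (hw.nonneg n)
      _ = S * (w n * w' (j + n + 1)) := mul_left_comm _ _ _

theorem IsEfficient.cost_le (hd : Q.IsEfficient d) (n : ℕ) :
    Q.cost d n ≤ Q.h n + ∑ k, (Q.M k : ℝ) * Q.c k :=
  add_le_add_right (Finset.sum_le_sum fun k _ =>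
    mul_le_mul_of_nonneg_right (Nat.cast_le.2 ((hd n).1 k)) (Q.c_nonneg k)) _

theorem IsStationary.summable_mul_h (hw : Q.IsStationary d w)
    (hs : Summable fun n => w n * Q.cost d n) : Summable fun n => w n * Q.h n := by
  have hconst := (hw.hasSum.mul_right (Q.h 0)).summable
  have hexcess : Summable fun n => w n * (Q.h n - Q.h 0) := by
    refine Summable.of_nonneg_of_le
      (fun n => mul_nonneg (hw.nonneg n) (sub_nonneg.2 (Q.h_mono (Nat.zero_le n))))
      (fun n => mul_le_mul_of_nonneg_left (sub_le_sub_right (Q.h_le_cost d n) _) (hw.nonneg n)) ?_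
    simpa only [mul_sub] using hs.sub hconst
  exact (hexcess.add hconst).congr fun n => by ring

/-- The boundary term of the performance difference formula is dominated by the tail of a
convergent series. -/
theorem IsStationary.lam_mul_le_tsum (hd : Q.IsEfficient d) (hw : Q.IsStationary d w)
    (hG : Q.SolvesPoisson d η G) (hη : HasSum (fun n => w n * Q.cost d n) η)
    {u : ℕ → ℝ} {n : ℕ} (hn : 0 < w n) (hh : η ≤ Q.h n)
    (hle : ∀ j, w' n * w (j + n) ≤ w n * w' (j + n)) (hw' : ∀ n, 0 ≤ w' n)
    (hu : Summable fun n => w' n * u n) (hcost : ∀ n, Q.cost d n - η ≤ u n) :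
    Q.lam * w' n * G (n + 1) ≤ ∑' j, w' (j + (n + 1)) * u (j + (n + 1)) := by
  have htail := (hw.hasSum_tail hd hG hη n).mul_left (w' n)
  have htail' := ((summable_nat_add_iff (n + 1)).2 hu).hasSum.mul_left (w n)
  have hterm (j : ℕ) : w' n * (w (j + (n + 1)) * (Q.cost d (j + (n + 1)) - η))
      ≤ w n * (w' (j + (n + 1)) * u (j + (n + 1))) := by
    have hcost0 : 0 ≤ Q.cost d (j + (n + 1)) - η :=
      sub_nonneg.2 (hh.trans ((Q.h_mono (by omega)).trans (Q.h_le_cost d _)))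
    have hratio := hle (j + 1)
    rw [add_assoc, add_comm 1 n] at hratio
    rw [← mul_assoc, ← mul_assoc]
    exact (mul_le_mul_of_nonneg_right hratio hcost0).trans
      (mul_le_mul_of_nonneg_left (hcost _) (mul_nonneg hn.le (hw' _)))
  refine le_of_mul_le_mul_left ?_ hn
  calc w n * (Q.lam * w' n * G (n + 1)) = w' n * (Q.lam * w n * G (n + 1)) := by ring
    _ ≤ _ := hasSum_le hterm htail htail'

theorem SolvesPoisson.le_of_isBestAction (hG : Q.SolvesPoisson d η G)
    (hbest : ∀ n, Q.IsBestAction n (G n) (d n)) (hd' : Q.IsEfficient d')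
    (hw' : Q.IsStationary d' w') (hζ : HasSum (fun n => w' n * Q.cost d' n) ζ) {t : ℕ → ℝ}
    (ht : Tendsto t atTop (𝓝 0)) (hle : ∀ᶠ N in atTop, Q.lam * w' N * G (N + 1) ≤ t N) :
    η ≤ ζ := by
  have hlim := (hw'.tendsto_sum_cost_sub hζ η).add ht
  rw [add_zero] at hlim
  refine sub_nonneg.1 (ge_of_tendsto hlim (hle.mono fun N hN => ?_))
  calc 0 ≤ ∑ i ∈ Finset.range (N + 1), w' i * (Q.net (d i) (G i) - Q.net (d' i) (G i)) :=
        Finset.sum_nonneg fun i _ =>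
          mul_nonneg (hw'.nonneg i) (sub_nonneg.2 ((hbest i).2 _ (hd' i)))
    _ = _ := (hw'.sum_cost_sub_add_of_solvesPoisson hd' hG N).symm
    _ ≤ _ := add_le_add_right hN _

/-- Since `d` eventually uses all servers, its tail costs are dominated by those of `d'`, so that
the boundary term of the performance difference formula vanishes in the limit. -/
theorem SolvesPoisson.le_of_obeysRule (hQ : Q.ScaleEconomies) (hG : Q.SolvesPoisson d η G)
    (hd : Q.IsEfficient d) (hw : Q.IsStationary d w) (hr : ∀ n, 0 < Q.rate d (n + 1))
    (hη : HasSum (fun n => w n * Q.cost d n) η) (hrule : ∀ n, Q.ObeysRule n (G n) (d n))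
    (hd' : Q.IsEfficient d') (hw' : Q.IsStationary d' w')
    (hζ : HasSum (fun n => w' n * Q.cost d' n) ζ) : η ≤ ζ := by
  set C := ∑ k, (Q.M k : ℝ) * Q.c k
  have hu : Summable fun n => w' n * (Q.h n + (C - η)) := by
    simpa only [mul_add] using
      (hw'.summable_mul_h hζ.summable).add (hw'.hasSum.summable.mul_right (C - η))
  have hcost (n : ℕ) : Q.cost d n - η ≤ Q.h n + (C - η) := by
    rw [← add_sub_assoc]
    exact sub_le_sub_right (hd.cost_le n) η
  obtain ⟨N, hN⟩ := (hG.eventually_eq_M hd hw hr hη hrule).exists_forall_of_atTop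
  refine hG.le_of_isBestAction (fun n => (hrule n).isBestAction hQ (hd n)) hd' hw' hζ
    ((tendsto_sum_nat_add fun n => w' n * (Q.h n + (C - η))).comp (tendsto_add_atTop_nat 1)) ?_
  filter_upwards [eventually_ge_atTop (N + 1), Q.h_tendsto.eventually_ge_atTop η] with n hn hh
  exact hw.lam_mul_le_tsum hd hG hη (hw.pos hr n) hh
    (hw.mul_le_mul_of_full hd' hw' (fun m hm => hN m (by omega)) (hr N) hn) hw'.nonneg hu hcost

theorem isOptimal_of_obeysRule (hQ : Q.ScaleEconomies) (hd : Q.IsEfficient d)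
    (hg : Q.IsPotential d g) (hrule : ∀ n, Q.ObeysRule n (prf g n) (d n)) : Q.IsOptimal d := by
  obtain ⟨η, hη, -⟩ := id hg
  have hG := hg.solvesPoisson hd hη
  obtain ⟨w, x, hw, hx, -⟩ := exists_isStationary hd hη
  obtain ⟨k, hk, hκ⟩ := hw.exists_cheapest hd
  have hr (n : ℕ) : 0 < Q.rate d (n + 1) := rate_pos_of_ne_zero <|
    (hrule (n + 1)).ne_zero n.succ_pos hk (hG.lt_of_obeysRule hd hw hrule hκ n)
  obtain rfl := hη.unique (hw.hasAverageCost hd hr hx)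
  refine ⟨hd, η, hη, fun d' η' hd' hη' => ?_⟩
  obtain ⟨w', ζ, hw', hζ, hle⟩ := exists_isStationary hd' hη'
  exact (hG.le_of_obeysRule hQ hd hw hr hx hrule hd' hw' hζ).trans hle

end Sufficiency

section Modification

variable {K : ℕ} {Q : GroupServerQueue K} {d d' : ℕ → Fin K → ℕ} {w w' : ℕ → ℝ} {ζ : ℝ} {N : ℕ}

theorem rate_congr {n : ℕ} (h : d' n = d n) : Q.rate d' n = Q.rate d n := by
  rw [rate, rate, h]

theorem cost_congr {n : ℕ} (h : d' n = d n) : Q.cost d' n = Q.cost d n := by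
  rw [cost, cost, h]

theorem summable_mul_cost_of_eq_above {C : ℝ} (heq : ∀ n, N < n → d' n = d n)
    (hww' : ∀ n, N ≤ n → w' n = C * w n) (hs : Summable fun n => w n * Q.cost d n) :
    Summable fun n => w' n * Q.cost d' n := by
  rw [← summable_nat_add_iff (N + 1)] at hs ⊢
  refine (hs.mul_left C).congr fun n => ?_
  rw [hww' _ (by omega), cost_congr (heq _ (by omega)), mul_assoc]

namespace IsStationary

theorem ne_zero_of_le (hw : Q.IsStationary d w) {m n : ℕ} (hm : w m ≠ 0) (hmn : m ≤ n) :
    w n ≠ 0 := by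
  rcases hmn.eq_or_lt with rfl | hlt
  · exact hm
  · obtain ⟨n, rfl⟩ := Nat.exists_eq_add_one_of_ne_zero hlt.ne_bot
    exact fun hn => hm (hw.eq_zero_of_succ (by rw [hn, mul_zero]) (Nat.le_of_lt_succ hlt))

theorem exists_balance_of_eq_above (hw : Q.IsStationary d w) (heq : ∀ n, N < n → d' n = d n) :
    ∃ v : ℕ → ℝ, (∀ n, 0 ≤ v n) ∧ (∀ n, Q.lam * v n = Q.rate d' (n + 1) * v (n + 1)) ∧
      ∀ n, N ≤ n → v n = w n := by
  have hv (n : ℕ) (hn : N ≤ n) :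
      w (max n N) * ∏ i ∈ Finset.Ico n N, Q.rate d' (i + 1) / Q.lam = w n := by
    rw [max_eq_left hn, Finset.Ico_eq_empty_of_le hn, Finset.prod_empty, mul_one]
  refine ⟨fun n => w (max n N) * ∏ i ∈ Finset.Ico n N, Q.rate d' (i + 1) / Q.lam,
    fun n => mul_nonneg (hw.nonneg _) (Finset.prod_nonneg fun i _ =>
      div_nonneg (Q.rate_nonneg d' _) Q.lam_pos.le), fun n => ?_, hv⟩
  rcases le_or_gt N n with hn | hn
  · simp only [hv n hn, hv (n + 1) (by omega), hw.balance, rate_congr (heq (n + 1) (by omega))]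
  · have hlam := Q.lam_pos.ne'
    beta_reduce
    rw [Finset.prod_eq_prod_Ico_succ_bot hn, max_eq_right hn.le, max_eq_right hn]
    field_simp

theorem exists_of_eq_above (hw : Q.IsStationary d w) (heq : ∀ n, N < n → d' n = d n) :
    ∃ w', ∃ C > 0, Q.IsStationary d' w' ∧ ∀ n, N ≤ n → w' n = C * w n := by
  obtain ⟨v, hnonneg, hbal, hvw⟩ := hw.exists_balance_of_eq_above heq
  have hs : Summable v := by
    rw [← summable_nat_add_iff N]
    exact ((summable_nat_add_iff N).2 hw.hasSum.summable).congr fun n => (hvw _ (by omega)).symm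
  obtain ⟨m, hm⟩ := hw.exists_ne_zero
  have hpos : 0 < v (max m N) := by
    rw [hvw _ (le_max_right _ _)]
    exact (hw.nonneg _).lt_of_ne' (hw.ne_zero_of_le hm (le_max_left _ _))
  have hZ : 0 < ∑' n, v n := hs.tsum_pos hnonneg _ hpos
  refine ⟨fun n => (∑' n, v n)⁻¹ * v n, (∑' n, v n)⁻¹, inv_pos.2 hZ,
    ⟨fun n => mul_nonneg (inv_pos.2 hZ).le (hnonneg n), ?_, fun n => ?_⟩,
    fun n hn => by simp only [hvw n hn]⟩
  · simpa only [inv_mul_cancel₀ hZ.ne'] using hs.hasSum.mul_left (∑' n, v n)⁻¹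
  · rw [mul_left_comm, hbal, mul_left_comm]

theorem hasSum_rate (hd : Q.IsEfficient d) (hw : Q.IsStationary d w) :
    HasSum (fun n => w n * Q.rate d n) Q.lam := by
  rw [← hasSum_nat_add_iff' 1]
  simpa only [Finset.range_one, Finset.sum_singleton, hd.rate_zero, mul_zero, sub_zero, mul_one,
    hw.balance, mul_comm] using hw.hasSum.mul_left Q.lam

theorem hasSum_mul_h_sub_net (hd : Q.IsEfficient d) (hw : Q.IsStationary d w)
    (hζ : HasSum (fun n => w n * Q.cost d n) ζ) (x : ℝ) :
    HasSum (fun n => w n * (Q.h n - Q.net (d n) x)) (ζ - Q.lam * x) := by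
  refine (hζ.sub ((hw.hasSum_rate hd).mul_right x)).congr_fun fun n => ?_
  rw [Q.cost_eq d n x]
  ring

end IsStationary

end Modification

section Necessity

variable {K : ℕ} {Q : GroupServerQueue K} {d : ℕ → Fin K → ℕ} {w G : ℕ → ℝ} {η ζ κ : ℝ}
  {k : Fin K} {N : ℕ}

/-- `η` is a lower bound for the average costs of all policies. -/
def IsLowerCost (Q : GroupServerQueue K) (η : ℝ) : Prop :=
  ∀ d' η', Q.IsEfficient d' → Q.HasAverageCost d' η' → η ≤ η'

/-- The policy that follows `d` above `m`, and below uses a single server, of group `k`. -/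
def singleServerUpTo (d : ℕ → Fin K → ℕ) (k : Fin K) (m n : ℕ) : Fin K → ℕ :=
  if n = 0 then 0 else if n ≤ m then Pi.single k 1 else d n

theorem singleServerUpTo_of_lt {m n : ℕ} (h : m < n) : singleServerUpTo d k m n = d n := by
  rw [singleServerUpTo, if_neg (by omega), if_neg (by omega)]

theorem singleServerUpTo_of_le {m n : ℕ} (h0 : n ≠ 0) (h : n ≤ m) :
    singleServerUpTo d k m n = Pi.single k 1 := by
  rw [singleServerUpTo, if_neg h0, if_pos h]

theorem isFeasible_zero (Q : GroupServerQueue K) (n : ℕ) : Q.IsFeasible n 0 :=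
  ⟨fun _ => Nat.zero_le _, by simp⟩

theorem isFeasible_single (hk : 0 < Q.M k) {n : ℕ} (hn : 0 < n) :
    Q.IsFeasible n (Pi.single k 1) := by
  simpa only [zero_add] using (Q.isFeasible_zero n).add_single hk (by simpa using hn)

theorem IsEfficient.singleServerUpTo (hd : Q.IsEfficient d) (hk : 0 < Q.M k) (m : ℕ) :
    Q.IsEfficient (singleServerUpTo d k m) := by
  intro n
  rw [GroupServerQueue.singleServerUpTo]
  split_ifs with h0
  · exact Q.isFeasible_zero n
  · exact isFeasible_single hk (Nat.pos_of_ne_zero h0)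
  · exact hd n

theorem rate_singleServerUpTo_pos {m : ℕ} (hr : ∀ n, m ≤ n → 0 < Q.rate d (n + 1)) (n : ℕ) :
    0 < Q.rate (singleServerUpTo d k m) (n + 1) := by
  rcases lt_or_ge m (n + 1) with h | h
  · rw [rate_congr (singleServerUpTo_of_lt h)]
    exact hr n (by omega)
  · refine rate_pos_of_ne_zero ?_
    rw [singleServerUpTo_of_le n.succ_ne_zero h]
    exact Pi.single_ne_zero_iff.2 one_ne_zero

theorem net_singleServerUpTo {m n : ℕ} (h : n ≤ m) :
    Q.net (singleServerUpTo d k m n) (Q.c k / Q.mu k) = 0 := by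
  rcases Nat.eq_zero_or_pos n with rfl | hn
  · exact Q.net_zero _
  · rw [singleServerUpTo_of_le hn.ne' h, net_single, reward_div]

theorem net_le_net_singleServerUpTo (hd : Q.IsEfficient d)
    (hκ : ∀ l, 0 < Q.M l → Q.c k / Q.mu k ≤ Q.c l / Q.mu l) (m n : ℕ) :
    Q.net (d n) (Q.c k / Q.mu k) ≤ Q.net (singleServerUpTo d k m n) (Q.c k / Q.mu k) := by
  rcases lt_or_ge m n with h | h
  · rw [singleServerUpTo_of_lt h]
  · rw [net_singleServerUpTo h]
    exact net_nonpos (hd n).1 hκ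

theorem IsStationary.sum_lt_of_le_h (hd : Q.IsEfficient d) (hw : Q.IsStationary d w)
    (hκ : ∀ l, 0 < Q.M l → κ ≤ Q.c l / Q.mu l) {θ S : ℝ} (hθ : θ ≤ Q.h (N + 1))
    (hS : HasSum (fun n => w n * (Q.h n - Q.net (d n) κ - θ)) S) :
    ∑ i ∈ Finset.range (N + 1), w i * (Q.h i - Q.net (d i) κ - θ) < S := by
  have hle (n : ℕ) : Q.h n - θ ≤ Q.h n - Q.net (d n) κ - θ := by
    linarith [net_nonpos (hd n).1 hκ]
  obtain ⟨m, hm⟩ := hw.exists_ne_zero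
  obtain ⟨i, hi, hmi⟩ := ((Q.h_tendsto.comp (tendsto_add_atTop_nat (N + 1))).eventually_gt_atTop θ
    |>.and (eventually_ge_atTop m)).exists
  refine sub_pos.1 (hasSum_lt (i := i) (fun j => ?_) ?_ hasSum_zero
    ((hasSum_nat_add_iff' (N + 1)).2 hS))
  · exact mul_nonneg (hw.nonneg _)
      ((sub_nonneg.2 (hθ.trans (Q.h_mono (Nat.le_add_left _ _)))).trans (hle _))
  · exact mul_pos ((hw.nonneg _).lt_of_ne' (hw.ne_zero_of_le hm (by omega)))
      ((sub_pos.2 hi).trans_le (hle _))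

namespace IsLowerCost

/-- Otherwise it would pay to use a single cheapest server up to state `N + 1`. -/
theorem sum_lt_of_h_lt (hη : Q.IsLowerCost η) (hd : Q.IsEfficient d) (hw : Q.IsStationary d w)
    (hζ : HasSum (fun n => w n * Q.cost d n) ζ) (hr : ∀ n, N < n → 0 < Q.rate d (n + 1))
    (hk : 0 < Q.M k) (hκ : ∀ l, 0 < Q.M l → Q.c k / Q.mu k ≤ Q.c l / Q.mu l) {θ : ℝ}
    (hθ : η - Q.lam * (Q.c k / Q.mu k) = θ) (hlt : Q.h (N + 1) < θ) :
    ∑ i ∈ Finset.range (N + 1), w i * (Q.h i - Q.net (d i) (Q.c k / Q.mu k) - θ) < ζ - η := by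
  set κ := Q.c k / Q.mu k
  set d' := singleServerUpTo d k (N + 1)
  have heq (n : ℕ) (hn : N + 1 < n) : d' n = d n := singleServerUpTo_of_lt hn
  have hd' := hd.singleServerUpTo hk (N + 1)
  have hr' : ∀ n, 0 < Q.rate d' (n + 1) := rate_singleServerUpTo_pos hr
  obtain ⟨w', C, hC, hw', hww'⟩ := hw.exists_of_eq_above heq
  obtain ⟨ζ', hζ'⟩ := summable_mul_cost_of_eq_above heq hww' hζ.summable
  have hηζ' : η ≤ ζ' := hη d' ζ' hd' (hw'.hasAverageCost hd' hr' hζ')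
  have hshift (z : ℝ) : z - Q.lam * κ - θ = z - η := by linarith
  have hsum := (hasSum_mul_sub_const_iff hw.hasSum (b := θ)).2 (hw.hasSum_mul_h_sub_net hd hζ κ)
  have hsum' := (hasSum_mul_sub_const_iff hw'.hasSum (b := θ)).2
    (hw'.hasSum_mul_h_sub_net hd' hζ' κ)
  rw [hshift] at hsum hsum'
  have hhead : ∑ i ∈ Finset.range (N + 1), w' i * (Q.h i - Q.net (d' i) κ - θ) < 0 := by
    refine Finset.sum_neg (fun i hi => ?_) Finset.nonempty_range_add_one
    have hi' : i ≤ N + 1 := (Finset.mem_range.1 hi).le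
    rw [net_singleServerUpTo hi', sub_zero]
    exact mul_neg_of_pos_of_neg (hw'.pos hr' i) (sub_neg.2 ((Q.h_mono hi').trans_lt hlt))
  have htail := hasSum_le (fun i => ?_) ((hasSum_nat_add_iff' (N + 1)).2 hsum')
    (((hasSum_nat_add_iff' (N + 1)).2 hsum).mul_left C)
  · exact sub_pos.1 (pos_of_mul_pos_right (by linarith : 0 < C * _) hC.le)
  · rw [hww' _ (Nat.le_add_left _ _), mul_assoc]
    exact mul_le_mul_of_nonneg_left (mul_le_mul_of_nonneg_left
      (sub_le_sub_right (sub_le_sub_left (net_le_net_singleServerUpTo hd hκ _ _) _) _)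
      (hw.nonneg _)) hC.le

theorem sum_lt (hη : Q.IsLowerCost η) (hd : Q.IsEfficient d) (hw : Q.IsStationary d w)
    (hζ : HasSum (fun n => w n * Q.cost d n) ζ) (hr : ∀ n, N < n → 0 < Q.rate d (n + 1))
    (hk : 0 < Q.M k) (hκ : ∀ l, 0 < Q.M l → Q.c k / Q.mu k ≤ Q.c l / Q.mu l) :
    ∑ i ∈ Finset.range (N + 1), w i * (Q.cost d i - η) + Q.lam * w N * (Q.c k / Q.mu k)
      < ζ - η := by
  set κ := Q.c k / Q.mu k
  have hsum := (hasSum_mul_sub_const_iff hw.hasSum (b := η - Q.lam * κ)).2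
    (hw.hasSum_mul_h_sub_net hd hζ κ)
  rw [sub_sub_sub_cancel_right] at hsum
  refine (hw.sum_cost_sub_add hd η (fun _ => κ) N).trans_lt ?_
  have hterm (i : ℕ) : w i * (Q.lam * κ + Q.h i - Q.net (d i) κ - η)
      = w i * (Q.h i - Q.net (d i) κ - (η - Q.lam * κ)) := by ring
  simp only [hterm]
  rcases le_or_gt (η - Q.lam * κ) (Q.h (N + 1)) with hle | hlt
  · exact hw.sum_lt_of_le_h hd hκ hle hsum
  · exact hη.sum_lt_of_h_lt hd hw hζ hr hk hκ rfl hlt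

theorem rate_pos (hη : Q.IsLowerCost η) (hd : Q.IsEfficient d) (hw : Q.IsStationary d w)
    (hζ : HasSum (fun n => w n * Q.cost d n) ζ) (hle : ζ ≤ η) (hk : 0 < Q.M k)
    (hκ : ∀ l, 0 < Q.M l → Q.c k / Q.mu k ≤ Q.c l / Q.mu l) (n : ℕ) : 0 < Q.rate d (n + 1) := by
  have hzero {N : ℕ} (h : Q.rate d (N + 1) = 0) {m : ℕ} (hm : m ≤ N) : w m = 0 :=
    hw.eq_zero_of_succ (by rw [h, zero_mul]) hm
  have hstep (N : ℕ) (hr : ∀ n, N < n → 0 < Q.rate d (n + 1)) : 0 < Q.rate d (N + 1) := by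
    refine (Q.rate_nonneg d _).lt_of_ne' fun h => ?_
    have hlt := hη.sum_lt hd hw hζ hr hk hκ
    rw [Finset.sum_eq_zero fun i hi => by
      rw [hzero h (Finset.mem_range_succ_iff.1 hi), zero_mul], hzero h le_rfl] at hlt
    linarith
  obtain ⟨m, hm⟩ := hw.exists_ne_zero
  suffices hall : ∀ j n, m ≤ n + j → 0 < Q.rate d (n + 1) from hall m n (by omega)
  intro j
  induction j with
  | zero => exact fun n hn => (Q.rate_nonneg d _).lt_of_ne' fun h => hm (hzero h hn)
  | succ j ih => exact fun n hn => hstep n fun i hi => ih i (by omega)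

theorem lt_factor (hη : Q.IsLowerCost η) (hd : Q.IsEfficient d) (hw : Q.IsStationary d w)
    (hr : ∀ n, 0 < Q.rate d (n + 1)) (hs : HasSum (fun n => w n * Q.cost d n) η)
    (hG : Q.SolvesPoisson d η G) (hk : 0 < Q.M k)
    (hκ : ∀ l, 0 < Q.M l → Q.c k / Q.mu k ≤ Q.c l / Q.mu l) (n : ℕ) :
    Q.c k / Q.mu k < G (n + 1) := by
  have hlt := hη.sum_lt hd hw hs (N := n) (fun n _ => hr n) hk hκ
  have hfactor := hw.lam_mul_eq hd hG n
  exact lt_of_mul_lt_mul_left (by linarith : Q.lam * w n * (Q.c k / Q.mu k) < _)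
    (mul_pos Q.lam_pos (hw.pos hr n)).le

/-- Changing `d` in the single state `n` changes the average cost by a positive multiple of the
loss of net benefit in that state. -/
theorem net_le_of_ne_zero (hη : Q.IsLowerCost η) (hd : Q.IsEfficient d) (hw : Q.IsStationary d w)
    (hr : ∀ n, 0 < Q.rate d (n + 1)) (hs : HasSum (fun n => w n * Q.cost d n) η)
    (hG : Q.SolvesPoisson d η G) {n : ℕ} {a : Fin K → ℕ} (hfeas : Q.IsFeasible n a) (ha : a ≠ 0) :
    Q.net a (G n) ≤ Q.net (d n) (G n) := by
  set d' := Function.update d n a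
  have hself : d' n = a := Function.update_self _ _ _
  have hne (m : ℕ) (hm : m ≠ n) : d' m = d m := Function.update_of_ne hm _ _
  have hd' : Q.IsEfficient d' :=
    Function.forall_update_iff d (fun m b => Q.IsFeasible m b) |>.2 ⟨hfeas, fun m _ => hd m⟩
  have hr' (m : ℕ) : 0 < Q.rate d' (m + 1) := by
    rcases eq_or_ne (m + 1) n with hm | hm
    · exact rate_pos_of_ne_zero (by rwa [hm, hself])
    · rw [rate_congr (hne _ hm)]
      exact hr m
  have heq (m : ℕ) (hm : n < m) : d' m = d m := hne m hm.ne'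
  obtain ⟨w', C, -, hw', hww'⟩ := hw.exists_of_eq_above heq
  obtain ⟨ζ', hζ'⟩ := summable_mul_cost_of_eq_above heq hww' hs.summable
  have hηζ' : η ≤ ζ' := hη d' ζ' hd' (hw'.hasAverageCost hd' hr' hζ')
  have hboundary : Tendsto (fun N => Q.lam * w' N * G (N + 1)) atTop (𝓝 0) := by
    have hlim := (hw.tendsto_sum_cost_sub hs η).neg.const_mul C
    rw [sub_self, neg_zero, mul_zero] at hlim
    refine hlim.congr' ((eventually_ge_atTop n).mono fun N hN => ?_)
    rw [← hw.lam_mul_eq hd hG N]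
    simp only [hww' N hN]
    ring
  have hdiff : ζ' - η + 0 = w' n * (Q.net (d n) (G n) - Q.net a (G n)) := by
    refine tendsto_nhds_unique ((hw'.tendsto_sum_cost_sub hζ' η).add hboundary)
      (tendsto_const_nhds.congr' ((eventually_ge_atTop n).mono fun N hN => ?_))
    beta_reduce
    rw [hw'.sum_cost_sub_add_of_solvesPoisson hd' hG, Finset.sum_eq_single_of_mem n
      (Finset.mem_range_succ_iff.2 hN) fun m _ hm => by rw [hne m hm, sub_self, mul_zero], hself]
  exact sub_nonneg.1 (nonneg_of_mul_nonneg_right (by linarith) (hw'.pos hr' n))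

theorem isBestAction (hη : Q.IsLowerCost η) (hd : Q.IsEfficient d) (hw : Q.IsStationary d w)
    (hr : ∀ n, 0 < Q.rate d (n + 1)) (hs : HasSum (fun n => w n * Q.cost d n) η)
    (hG : Q.SolvesPoisson d η G) (hk : 0 < Q.M k)
    (hκ : ∀ l, 0 < Q.M l → Q.c k / Q.mu k ≤ Q.c l / Q.mu l) (n : ℕ) :
    Q.IsBestAction n (G n) (d n) := by
  refine ⟨hd n, fun a ha => ?_⟩
  rcases ne_or_eq a 0 with ha0 | rfl
  · exact hη.net_le_of_ne_zero hd hw hr hs hG ha ha0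
  rcases n with _ | n
  · rw [show d 0 = 0 from funext hd.zero]
  · have hreward := (Q.reward_pos_iff k _).2 (hη.lt_factor hd hw hr hs hG hk hκ n)
    have hsingle := hη.net_le_of_ne_zero hd hw hr hs hG (isFeasible_single hk n.succ_pos)
      (Pi.single_ne_zero_iff.2 one_ne_zero)
    rw [net_single] at hsingle
    rw [net_zero]
    exact hreward.le.trans hsingle

end IsLowerCost

theorem IsOptimal.exists_obeysRule (hQ : Q.ScaleEconomies) (hopt : Q.IsOptimal d) :
    ∃ g, Q.IsPotential d g ∧ ∀ n, Q.ObeysRule n (prf g n) (d n) := by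
  obtain ⟨hd, η, hη, hlow⟩ := hopt
  replace hlow : Q.IsLowerCost η := hlow
  obtain ⟨w, ζ, hw, hζ, hle⟩ := exists_isStationary hd hη
  obtain ⟨k, hk, hκ⟩ := hw.exists_cheapest hd
  have hr := hlow.rate_pos hd hw hζ hle hk hκ
  obtain rfl := hη.unique (hw.hasAverageCost hd hr hζ)
  have hg := hw.isPotential hd hr hζ
  have hG := hg.solvesPoisson hd hη
  exact ⟨_, hg, fun n => (hlow.isBestAction hd hw hr hζ hG hk hκ n).obeysRule hQ⟩

end Necessity

end GroupServerQueue

theorem theorem7 {K : ℕ} (Q : GroupServerQueue K) (hQ : Q.ScaleEconomies)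
    (d : ℕ → Fin K → ℕ) (hd : Q.IsEfficient d) :
    (Q.IsOptimal d ↔
      ∃ g, Q.IsPotential d g ∧ ∀ n k,
        (Q.c k / Q.mu k < prf g n →
          d n k = min (Q.M k) (n - ∑ l ∈ Finset.Iio k, d n l)) ∧
        (prf g n < Q.c k / Q.mu k → d n k = 0)) ∧
    (∀ g, Q.IsPotential d g → (∀ n k, prf g n = Q.c k / Q.mu k → d n k = 0) →
      (Q.IsOptimal d ↔ ∀ n k,
        (Q.c k / Q.mu k < prf g n →
          d n k = min (Q.M k) (n - ∑ l ∈ Finset.Iio k, d n l)) ∧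
        (¬ Q.c k / Q.mu k < prf g n → d n k = 0))) := by
  refine ⟨⟨fun hopt => hopt.exists_obeysRule hQ, fun ⟨g, hg, hrule⟩ =>
    GroupServerQueue.isOptimal_of_obeysRule hQ hd hg hrule⟩, fun g hg hoff => ⟨fun hopt => ?_,
    fun hrule => GroupServerQueue.isOptimal_of_obeysRule hQ hd hg fun n k =>
      ⟨(hrule n k).1, fun hlt => (hrule n k).2 hlt.not_gt⟩⟩⟩
  obtain ⟨g', hg', hrule⟩ := hopt.exists_obeysRule hQ
  rw [hg'.prf_eq hg] at hrule
  refine fun n k => ⟨(hrule n k).1, fun hnot => ?_⟩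
  rcases (not_lt.1 hnot).lt_or_eq with hlt | heq
  · exact (hrule n k).2 hlt
  · exact hoff n k heq
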